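/- Let $d\in\{2,3\}$, let $\Omega\subset\mathbb{R}^d$ be a bounded polyhedral Lipschitz domain with a decomposition $\partial\Omega=\Gamma_D\cup\Gamma_N$, $\Gamma_N=\partial\Omega\setminus\Gamma_D$, and let $\mathcal{T}_h$ be a regular (conforming) triangulation of $\Omega$ into triangles ($d=2$) or tetrahedra ($d=3$) with set of sides $\mathcal{S}_h$. Let $x_T,x_S$ denote the barycenters of elements $T$ and sides $S$, let $\mathcal{L}^k(\mathcal{T}_h)$ be the space of (discontinuous) elementwise polynomial functions of degree at most $k$, let $\Pi_{h,0}$ be the $L^2$ projection onto elementwise constant functions or vector fields, and let $\nabla_h$ be the elementwise gradient. Let $$\mathcal{S}^{1,cr}_D(\mathcal{T}_h)=\{v_h\in \mathcal{L}^1(\mathcal{T}_h): v_h \text{ continuous in } x_S \text{ for all } S\in\mathcal{S}_h,\ v_h(x_S)=0 \text{ for all } S\in\mathcal{S}_h \text{ with } S\subset\Gamma_D\},$$ where sides are regarded as relatively open in the condition $S\subset\Gamma_D$, and let $\mathcal{RT}^0_N(\mathcal{T}_h)$ be the set of all $y_h\in L^1(\Omega;\mathbb{R}^d)$ with distributional divergence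 $\operatorname{div} y_h\in L^1(\Omega)$ such that for every $T\in\mathcal{T}_h$ there are $a_T\in\mathbb{R}^d$, $b_T\in\mathbb{R}$ with $y_h|_T(x)=a_T+b_T(x-x_T)$, and such that $y_h\cdot n=0$ on $\Gamma_N$ (in the relative interiors of the boundary sides), where $n$ is the outer unit normal on $\partial\Omega$. Let $\phi:\mathbb{R}^d\to\mathbb{R}\cup\{+\infty\}$ be proper, convex and lower semicontinuous, with convex conjugate $\phi^*(t)=\sup_{s\in\mathbb{R}^d} t\cdot s-\phi(s)$. Then for every $\overline{u}_h\in\Pi_{h,0}\mathcal{S}^{1,cr}_D(\mathcal{T}_h)$ we have, in $[-\infty,+\infty]$, $$\inf\Big\{\int_\Omega\phi(\nabla_h u_h)\,dx: u_h\in\mathcal{S}^{1,cr}_D(\mathcal{T}_h),\ \Pi_{h,0}u_h=\overline{u}_h\Big\}\ \ge\ \sup\Big\{-\int_\Omega \big(\phi^*(\Pi_{h,0}z_h)+\overline{u}_h\operatorname{div} z_h\big)\,dx: z_h\in\mathcal{RT}^0_N(\mathcal{T}_h)\Big\}.$$ If in addition $\phi\in C^1(\mathbb{R}^d)$ (in particular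 $\phi$ is finite everywhere), then equality holds. -/

import Mathlib

open MeasureTheory
open scoped Topology

namespace DiscreteDuality

/-- The Euclidean space `ℝ^d`. -/
abbrev Rd (d : ℕ) := EuclideanSpace ℝ (Fin d)

section Domain

variable {d : ℕ}

/-- A bounded Lipschitz domain: a nonempty, bounded, connected open set which, near each of its
boundary points and in suitable Cartesian coordinates, is the strict epigraph of a Lipschitz
function of the first `d - 1` coordinates. Here `ν` is the direction of the last coordinate, so that
`y - ⟪ν, y⟫ ν` is the projection of `y` onto the hyperplane of the other ones. -/
structure IsBoundedLipschitzDomain (Ω : Set (Rd d)) : Prop where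
  isOpen : IsOpen Ω
  isConnected : IsConnected Ω
  isBounded : Bornology.IsBounded Ω
  lipschitz_boundary : ∀ x ∈ frontier Ω, ∃ ν : Rd d, ‖ν‖ = 1 ∧
    ∃ (K : NNReal) (γ : Rd d → ℝ), LipschitzWith K γ ∧
      ∀ᶠ y in 𝓝 x, y ∈ Ω ↔ γ (y - inner ℝ ν y • ν) < inner ℝ ν y

/-- A regular (conforming) triangulation of `Ω`: a finite simplicial complex, each of whose
simplices is a face of a `d`-dimensional one, and whose simplices cover exactly the closure
of `Ω`. In particular `Ω` is polyhedral. -/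
structure Triangulation (Ω : Set (Rd d)) extends Geometry.SimplicialComplex ℝ (Rd d) where
  finite_faces : faces.Finite
  pure : ∀ S ∈ faces, ∃ T ∈ faces, S ⊆ T ∧ T.card = d + 1
  space_eq : toSimplicialComplex.space = closure Ω

/-- The barycenter (midpoint) of the simplex with vertex set `S`. -/
noncomputable def barycenter (S : Finset (Rd d)) : Rd d :=
  (S.card : ℝ)⁻¹ • ∑ v ∈ S, v

/-- The closed simplex with vertex set `S`. -/
def cell (S : Finset (Rd d)) : Set (Rd d) := convexHull ℝ (S : Set (Rd d))

/-- The relative interior of the simplex with vertex set `S`. -/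
def openCell (S : Finset (Rd d)) : Set (Rd d) := intrinsicInterior ℝ (cell S)

/-- `n` is the outer unit normal of the simplex with vertex set `T` on its side `S`. -/
def IsOuterUnitNormal (T S : Finset (Rd d)) (n : Rd d) : Prop :=
  ‖n‖ = 1 ∧ (∀ v ∈ S, ∀ w ∈ S, inner ℝ n (v - w) = 0) ∧
    ∀ z ∈ T, z ∉ S → ∀ v ∈ S, inner ℝ n (z - v) < 0

end Domain

namespace Triangulation

variable {d : ℕ} {Ω : Set (Rd d)}

/-- The elements, i.e. the triangles (`d = 2`) or tetrahedra (`d = 3`), given by their vertices. -/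
def Element (𝒯 : Triangulation Ω) : Type :=
  {T : Finset (Rd d) // T ∈ 𝒯.faces ∧ T.card = d + 1}

noncomputable instance (𝒯 : Triangulation Ω) : Fintype 𝒯.Element :=
  (𝒯.finite_faces.subset (fun _ h => h.1) :
    {T : Finset (Rd d) | T ∈ 𝒯.faces ∧ T.card = d + 1}.Finite).fintype

/-- The set of sides of elements. -/
def sides (𝒯 : Triangulation Ω) : Set (Finset (Rd d)) :=
  {S | S ∈ 𝒯.faces ∧ S.card = d}

/-- Elementwise constant functions with values in `F`; `w T` is the value on `T`. -/
abbrev L0 (𝒯 : Triangulation Ω) (F : Type) := 𝒯.Element → F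

/-- Discontinuous, elementwise affine functions with values in `F`. As the elements overlap only in
null sets and have nonempty interior, such an `L^∞` function is given by the family of its
restrictions to the elements, each of which is the restriction of a unique affine map `w T`. -/
abbrev L1 (𝒯 : Triangulation Ω) (F : Type) [NormedAddCommGroup F] [NormedSpace ℝ F] :=
  𝒯.Element → (Rd d →ᵃ[ℝ] F)

/-- The `L²` projection onto elementwise constant functions: the mean value on each element. -/
noncomputable def proj0 (𝒯 : Triangulation Ω) {F : Type} [NormedAddCommGroup F] [NormedSpace ℝ F]
    (w : 𝒯.L1 F) : 𝒯.L0 F :=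
  fun T => ⨍ x in cell T.1, w T x

/-- The elementwise gradient, an elementwise constant vector field. -/
noncomputable def gradH (𝒯 : Triangulation Ω) (u : 𝒯.L1 ℝ) : 𝒯.L0 (Rd d) :=
  fun T => gradient (fun x => u T x) (barycenter T.1)

/-- The Crouzeix-Raviart space: elementwise affine functions that are continuous in the midpoints
of the sides. -/
def CR (𝒯 : Triangulation Ω) : Set (𝒯.L1 ℝ) :=
  {u | ∀ S ∈ 𝒯.sides, ∀ T T' : 𝒯.Element, S ⊆ T.1 → S ⊆ T'.1 →
    u T (barycenter S) = u T' (barycenter S)}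

/-- The Crouzeix-Raviart functions that vanish in the midpoints of the (relatively open) sides
contained in `ΓD`. -/
def CRD (𝒯 : Triangulation Ω) (ΓD : Set (Rd d)) : Set (𝒯.L1 ℝ) :=
  {u | u ∈ 𝒯.CR ∧ ∀ S ∈ 𝒯.sides, openCell S ⊆ ΓD →
    ∀ T : 𝒯.Element, S ⊆ T.1 → u T (barycenter S) = 0}

/-- The function `g ∈ L^1(Ω)` is the distributional divergence of the vector field `y` in `Ω`:
`∫_Ω y · ∇η = - ∫_Ω g η` for all smooth functions `η` with compact support in `Ω`. -/
def HasWeakDiv (𝒯 : Triangulation Ω) (y : 𝒯.L1 (Rd d)) (g : Rd d → ℝ) : Prop :=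
  IntegrableOn g Ω ∧
    ∀ η : Rd d → ℝ, ContDiff ℝ ((⊤ : ℕ∞) : WithTop ℕ∞) η → HasCompactSupport η → tsupport η ⊆ Ω →
      ∑ T : 𝒯.Element, ∫ x in cell T.1, inner ℝ (y T x) (gradient η x) = - ∫ x in Ω, g x * η x

open Classical in
/-- The distributional divergence in `L^1(Ω)`, unique almost everywhere in `Ω` if it exists. -/
noncomputable def weakDiv (𝒯 : Triangulation Ω) (y : 𝒯.L1 (Rd d)) : Rd d → ℝ :=
  if h : ∃ g, 𝒯.HasWeakDiv y g then h.choose else 0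

/-- The lowest order Raviart-Thomas space: fields `y ∈ W^1(div; Ω)` that are of the form
`y(x) = a_T + b_T (x - x_T)` on every element `T`. -/
def RT (𝒯 : Triangulation Ω) : Set (𝒯.L1 (Rd d)) :=
  {y | (∃ g, 𝒯.HasWeakDiv y g) ∧
    ∀ T : 𝒯.Element, ∃ (a : Rd d) (b : ℝ), ∀ x, y T x = a + b • (x - barycenter T.1)}

/-- The Raviart-Thomas fields with `y · n = 0` on `ΓN`, where `n` is the outer unit normal on
the boundary of `Ω`, which exists in the relative interiors of the boundary sides. -/
def RTN (𝒯 : Triangulation Ω) (ΓN : Set (Rd d)) : Set (𝒯.L1 (Rd d)) :=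
  {y | y ∈ 𝒯.RT ∧ ∀ S ∈ 𝒯.sides, cell S ⊆ frontier Ω → ∀ T : 𝒯.Element, S ⊆ T.1 →
    ∀ n, IsOuterUnitNormal T.1 S n → ∀ x ∈ openCell S ∩ ΓN, inner ℝ (y T x) n = 0}

/-- The volume `|T|` of an element. -/
noncomputable def vol (𝒯 : Triangulation Ω) (T : 𝒯.Element) : ℝ := volume.real (cell T.1)

end Triangulation

section Convex

variable {d : ℕ}

/-- Proper, convex and lower semicontinuous functions `φ : ℝ^d → ℝ ∪ {+∞}`, where convexity is
convexity of the epigraph. -/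
structure IsProperConvexLsc (φ : Rd d → EReal) : Prop where
  ne_bot : ∀ s, φ s ≠ ⊥
  exists_ne_top : ∃ s, φ s ≠ ⊤
  convex : Convex ℝ {p : Rd d × ℝ | φ p.1 ≤ (p.2 : EReal)}
  lsc : LowerSemicontinuous φ

/-- `φ ∈ C^1(ℝ^d)`; in particular `φ` is finite everywhere. -/
def IsC1 (φ : Rd d → EReal) : Prop :=
  ∃ f : Rd d → ℝ, ContDiff ℝ 1 f ∧ ∀ s, φ s = (f s : EReal)

/-- The convex conjugate `φ^*(t) = sup_s t · s - φ(s)`. -/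
noncomputable def conj (φ : Rd d → EReal) (t : Rd d) : EReal :=
  ⨆ s : Rd d, ((inner ℝ t s : ℝ) : EReal) - φ s

end Convex

section Functionals

variable {d : ℕ} {Ω : Set (Rd d)}

/-- The primal functional `∫_Ω φ(∇_h u_h)`, an integral of an elementwise constant function. -/
noncomputable def primal (𝒯 : Triangulation Ω) (φ : Rd d → EReal) (u : 𝒯.L1 ℝ) : EReal :=
  ∑ T : 𝒯.Element, (𝒯.vol T : EReal) * φ (𝒯.gradH u T)

/-- The dual functional `- ∫_Ω (φ^*(Π_{h,0} z_h) + ū_h div z_h)`. -/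
noncomputable def dual (𝒯 : Triangulation Ω) (φ : Rd d → EReal) (ubar : 𝒯.L0 ℝ)
    (z : 𝒯.L1 (Rd d)) : EReal :=
  - ∑ T : 𝒯.Element, ((𝒯.vol T : EReal) * conj φ (𝒯.proj0 z T)
      + ((ubar T * ∫ x in cell T.1, 𝒯.weakDiv z x : ℝ) : EReal))

end Functionals

end DiscreteDuality

/-! On an element `T`, a Raviart-Thomas field `a_T + β_T (x - x_T)` equals `∑ c_v (x - v)` over the
vertices `v`. The summand `x - v` has zero normal component on every side through `v`, so `c_v`
(`fluxCoeff`) carries the flux through the opposite side, and `∑ c_v = β_T`. For affine `u` this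
gives the discrete integration by parts formula `sum_inner_gradH`: `∑_T |T| (a_T · ∇u + d β_T
u(x_T))` is `d` times the sum of flux times `u(x_S)` over all pairs of an element and one of its
sides. Grouped by sides, this sum vanishes for `u` in `CRD` and a field in `RTN`: `u(x_S)` is
single-valued and is zero on the sides in `ΓD`, while on every other side the fluxes add up to zero.
The Fenchel-Young inequality on each element then gives weak duality (`dual_le_primal`).

That a distributional divergence exists exactly when the fluxes through inner sides cancel is proved
in `hasWeakDiv_toFun0` and `HasWeakDiv.fluxJump_eq_zero`. Integrals over sides are expressed there
as volume integrals of `div ((x - v) η)` (`facetMean`), to which only the side opposite to `v`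
contributes.

For equality with finite infimum `m`, Hahn-Banach separates the strict epigraph of `p ↦ ∑ |T|
φ(p_T)` from the affine space of admissible gradients at height `m`
(`exists_dual_of_le_on_affineSubspace`). The separating functional is an elementwise constant field
`a`, orthogonal to the gradients of functions in `CRD` with zero means. Lagrange multipliers for the
mean constraints provide the slopes `β` that turn `a` into an element of `RTN`
(`exists_coeff_fluxJump_eq_zero`). The supremum over `p` splits into one conjugate per element
(`exists_sum_sup_le`). -/

namespace DiscreteDuality
-- Divergence theorem and facet means on a simplex
section SimplexCalculus

open Module Set

set_option linter.unusedSectionVars false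

variable {E : Type*} [NormedAddCommGroup E] [NormedSpace ℝ E] [FiniteDimensional ℝ E]
  [MeasurableSpace E] [BorelSpace E] (μ : Measure E) [μ.IsAddHaarMeasure]
  {ι : Type*} [Fintype ι] (b : AffineBasis ι ℝ E)

theorem homothety_eq (v x : E) (s : ℝ) : AffineMap.homothety v s x = v + s • (x - v) := by
  simp [AffineMap.homothety_apply, add_comm]

theorem coord_homothety (j : ι) (v x : E) (s : ℝ) :
    b.coord j (AffineMap.homothety v s x) = (1 - s) * b.coord j v + s * b.coord j x := by
  rw [AffineMap.homothety_eq_lineMap, AffineMap.apply_lineMap, AffineMap.lineMap_apply]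
  simp; ring

theorem setIntegral_image_homothety {A : Set E} (hA : MeasurableSet A) (v : E) {s : ℝ}
    (hs : 0 < s) (f : E → ℝ) :
    ∫ x in AffineMap.homothety v s '' A, f x ∂μ
      = s ^ finrank ℝ E * ∫ x in A, f (AffineMap.homothety v s x) ∂μ := by
  have hd : ∀ x ∈ A, HasFDerivWithinAt (AffineMap.homothety v s : E → E)
      (s • ContinuousLinearMap.id ℝ E) A x := by
    intro x _
    have : (AffineMap.homothety v s : E → E) = fun x => v + s • (x - v) := by
      ext x; exact homothety_eq v x s
    rw [this]
    exact ((((hasFDerivAt_id x).sub_const v).const_smul s).const_add v).hasFDerivWithinAt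
  have hinj : InjOn (AffineMap.homothety v s : E → E) A := by
    intro x _ y _ h
    simp only [homothety_eq, add_right_inj] at h
    have := smul_right_injective E hs.ne' h
    simpa using this
  rw [integral_image_eq_integral_abs_det_fderiv_smul μ hA hd hinj]
  rw [← integral_const_mul]
  congr 1
  ext x
  have : (s • ContinuousLinearMap.id ℝ E).det = s ^ finrank ℝ E := by
    rw [ContinuousLinearMap.det]
    have : ((s • ContinuousLinearMap.id ℝ E : E →L[ℝ] E) : E →ₗ[ℝ] E) = s • LinearMap.id := rfl
    rw [this, LinearMap.det_smul]; simp
  rw [this, abs_of_pos (by positivity), smul_eq_mul]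

/-- By the change of variables, the differentiated function is the integral of `η` over the copy of
`A` scaled by `s` about `v`. Its derivative at `s = 1` is the integral of `div ((x - v) η)`, which
brings in the divergence without any boundary integral. -/
theorem hasDerivAt_setIntegral_homothety {A : Set E} (hA : IsCompact A) (v : E) {η : E → ℝ}
    (hη : ContDiff ℝ 1 η) :
    HasDerivAt (fun s : ℝ => s ^ finrank ℝ E * ∫ x in A, η (AffineMap.homothety v s x) ∂μ)
      (∫ x in A, (fderiv ℝ η x (x - v) + finrank ℝ E * η x) ∂μ) 1 := by
  have hfd : Continuous (fderiv ℝ η) := hη.continuous_fderiv (by simp)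
  have hηc := hη.continuous
  have hF' : Continuous (fun p : ℝ × E => fderiv ℝ η (v + p.1 • (p.2 - v)) (p.2 - v)) := by
    fun_prop
  obtain ⟨C, hC⟩ := ((isCompact_Icc (a := (0 : ℝ)) (b := 2)).prod hA).exists_bound_of_continuousOn
    hF'.continuousOn
  have key := hasDerivAt_integral_of_dominated_loc_of_deriv_le (μ := μ.restrict A)
    (F := fun (s : ℝ) x => η (v + s • (x - v)))
    (F' := fun (s : ℝ) x => fderiv ℝ η (v + s • (x - v)) (x - v)) (x₀ := 1) (s := Icc 0 2)
    (bound := fun _ => C) (Icc_mem_nhds (by norm_num) (by norm_num))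
    (Filter.Eventually.of_forall fun s => Continuous.aestronglyMeasurable (by fun_prop))
    (ContinuousOn.integrableOn_compact hA (Continuous.continuousOn (by fun_prop)))
    (Continuous.aestronglyMeasurable (by fun_prop))
    ((ae_restrict_iff' hA.measurableSet).2 (Filter.Eventually.of_forall fun x hx s hs =>
      hC (s, x) ⟨hs, hx⟩))
    (by
      have : IsFiniteMeasure (μ.restrict A) := ⟨by simpa using hA.measure_lt_top⟩
      exact integrable_const _)
    (Filter.Eventually.of_forall fun x s _ => by
      have h1 : HasDerivAt (fun s : ℝ => v + s • (x - v)) (x - v) s := by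
        simpa using ((hasDerivAt_id s).smul_const (x - v)).const_add v
      exact ((hη.differentiable (by simp)) _).hasFDerivAt.comp_hasDerivAt s h1)
  have h2 := (hasDerivAt_pow (finrank ℝ E) (1 : ℝ)).mul key.2
  have hi : Integrable (fun x => η x) (μ.restrict A) :=
    ContinuousOn.integrableOn_compact hA hηc.continuousOn
  have hi' := key.1
  simp only [one_smul, add_sub_cancel, one_pow, mul_one, one_mul] at h2 hi'
  rw [integral_add hi' (hi.const_mul _), integral_const_mul, add_comm]
  simp only [homothety_eq]
  exact h2

/-- The linear part of a barycentric coordinate. -/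
noncomputable def coordL {ι : Type*} (b : AffineBasis ι ℝ E) (i : ι) : E →L[ℝ] ℝ :=
  LinearMap.toContinuousLinearMap (b.coord i).linear

theorem coordL_sub (i : ι) (x y : E) : coordL b i (x - y) = b.coord i x - b.coord i y :=
  (b.coord i).linearMap_vsub x y

/-- The closed simplex spanned by an affine basis. -/
def simplex {ι : Type*} (b : AffineBasis ι ℝ E) : Set E := convexHull ℝ (range b)

theorem mem_simplex {x : E} : x ∈ simplex b ↔ ∀ i, 0 ≤ b.coord i x := by
  rw [simplex, b.convexHull_eq_nonneg_coord]; rfl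

theorem isCompact_simplex : IsCompact (simplex b) :=
  (finite_range b).isCompact_convexHull ℝ

theorem convex_simplex : Convex ℝ (simplex b) := convex_convexHull ℝ _

theorem coord_le_one {x : E} (hx : x ∈ simplex b) (i : ι) : b.coord i x ≤ 1 := by
  rw [← b.sum_coord_apply_eq_one x]
  exact Finset.single_le_sum (fun j _ => (mem_simplex b).1 hx j) (Finset.mem_univ i)

theorem measureReal_simplex_pos : 0 < μ.real (simplex b) := by
  refine ENNReal.toReal_pos (ne_of_gt ?_) (isCompact_simplex b).measure_lt_top.ne
  refine Measure.measure_pos_of_nonempty_interior μ ?_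
  exact ⟨_, b.centroid_mem_interior_convexHull⟩

/-- Shrinking towards `b i` thus removes exactly the layer of points with `i`-th coordinate below `1
- s`, next to the facet opposite to `b i`. -/
theorem mem_image_homothety_simplex {i : ι} {s : ℝ} (hs : 0 < s) {x : E} :
    x ∈ AffineMap.homothety (b i) s '' simplex b ↔
      (∀ j, j ≠ i → 0 ≤ b.coord j x) ∧ 1 - s ≤ b.coord i x := by
  constructor
  · rintro ⟨y, hy, rfl⟩
    rw [mem_simplex] at hy
    refine ⟨fun j hj => ?_, ?_⟩
    · rw [coord_homothety b, b.coord_apply_ne hj, mul_zero, zero_add]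
      exact mul_nonneg hs.le (hy j)
    · rw [coord_homothety b, b.coord_apply_eq]
      nlinarith [mul_nonneg hs.le (hy i)]
  · rintro ⟨h1, h2⟩
    refine ⟨AffineMap.homothety (b i) s⁻¹ x, ?_, ?_⟩
    · rw [mem_simplex]
      intro j
      rw [coord_homothety b]
      by_cases hj : j = i
      · subst hj
        rw [b.coord_apply_eq]
        have : (1 - s⁻¹) * 1 + s⁻¹ * b.coord j x = s⁻¹ * (b.coord j x - (1 - s)) := by
          field_simp; ring
        rw [this]
        exact mul_nonneg (inv_nonneg.2 hs.le) (by linarith)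
      · rw [b.coord_apply_ne hj, mul_zero, zero_add]
        exact mul_nonneg (inv_nonneg.2 hs.le) (h1 j hj)
    · simp [homothety_eq, smul_smul, hs.ne']

theorem image_homothety_simplex_subset {i : ι} {s : ℝ} (hs : 0 < s) (hs1 : s ≤ 1) :
    AffineMap.homothety (b i) s '' simplex b ⊆ simplex b := by
  intro x hx
  rw [mem_image_homothety_simplex b hs] at hx
  rw [mem_simplex]
  intro j
  by_cases hj : j = i
  · subst hj; linarith [hx.2]
  · exact hx.1 j hj

theorem measurableSet_image_homothety_simplex (v : E) (s : ℝ) :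
    MeasurableSet (AffineMap.homothety v s '' simplex b) :=
  ((isCompact_simplex b).image (AffineMap.homothety_continuous v s)).measurableSet

/-- The integral over the simplex minus the one over its homothetic copy with centre `b i`. -/
theorem setIntegral_sub_homothety {i : ι} {s : ℝ} (hs : 0 < s) (hs1 : s ≤ 1) {η : E → ℝ}
    (hη : Continuous η) :
    (∫ x in simplex b, η x ∂μ)
        - s ^ finrank ℝ E * ∫ x in simplex b, η (AffineMap.homothety (b i) s x) ∂μ
      = ∫ x in simplex b \ AffineMap.homothety (b i) s '' simplex b, η x ∂μ := by
  rw [← setIntegral_image_homothety μ (isCompact_simplex b).measurableSet _ hs,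
    setIntegral_sdiff (measurableSet_image_homothety_simplex b _ _)
      (hη.continuousOn.integrableOn_compact (isCompact_simplex b))
      (image_homothety_simplex_subset b hs hs1)]

theorem measureReal_simplex_diff_homothety {i : ι} {s : ℝ} (hs : 0 < s) (hs1 : s ≤ 1) :
    μ.real (simplex b \ AffineMap.homothety (b i) s '' simplex b)
      = (1 - s ^ finrank ℝ E) * μ.real (simplex b) := by
  have h := setIntegral_sub_homothety μ b (i := i) hs hs1 (continuous_const (y := (1 : ℝ)))
  simp only [setIntegral_const, smul_eq_mul, mul_one] at h
  rw [← h]; ring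

/-- A point of the simplex other than `b i` projects from `b i` onto the opposite facet. -/
theorem exists_mem_facet [Nontrivial ι] {i : ι} {x : E} (hx : x ∈ simplex b) :
    ∃ y ∈ simplex b, b.coord i y = 0 ∧ x - y = b.coord i x • (b i - y) := by
  classical
  -- The projection from `b i` is undefined only at `x = b i`; there any other vertex serves as `y`.
  by_cases h : b.coord i x = 1
  · obtain ⟨j, hj⟩ := exists_ne i
    refine ⟨b j, subset_convexHull ℝ _ (mem_range_self j), b.coord_apply_ne hj.symm, ?_⟩
    have hz : ∀ k, k ≠ i → b.coord k x = 0 := by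
      intro k hk
      have := b.sum_coord_apply_eq_one x
      rw [← Finset.add_sum_erase _ _ (Finset.mem_univ i), h, add_eq_left] at this
      exact (Finset.sum_eq_zero_iff_of_nonneg (fun j _ => (mem_simplex b).1 hx j)).1 this k
        (by simp [hk])
    have : x = b i := by
      apply b.ext_elem
      intro k
      by_cases hk : k = i
      · subst hk; rw [h, b.coord_apply_eq]
      · rw [hz k hk, b.coord_apply_ne hk]
    rw [h, one_smul, this]
  · have h1 : 0 < 1 - b.coord i x := by
      have := coord_le_one b hx i
      rcases this.lt_or_eq with h' | h'
      · linarith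
      · exact absurd h' h
    have hy : ∀ j, b.coord j (AffineMap.homothety (b i) (1 - b.coord i x)⁻¹ x)
        = if j = i then 0 else (1 - b.coord i x)⁻¹ * b.coord j x := by
      intro j
      rw [coord_homothety b]
      split_ifs with hj
      · subst hj
        rw [b.coord_apply_eq]; field_simp; ring
      · rw [b.coord_apply_ne hj]; simp
    refine ⟨AffineMap.homothety (b i) (1 - b.coord i x)⁻¹ x, ?_, by simp [hy], ?_⟩
    · rw [mem_simplex]
      intro j
      rw [hy]
      split_ifs
      · exact le_rfl
      · exact mul_nonneg (inv_nonneg.2 h1.le) ((mem_simplex b).1 hx j)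
    · rw [homothety_eq]
      set c := b.coord i x
      have h2 : (1 - c) * (1 - c)⁻¹ = 1 := mul_inv_cancel₀ h1.ne'
      have h3 : (1 - c)⁻¹ - c * (1 - c)⁻¹ = 1 := by linarith
      have : x - (b i + (1 - c)⁻¹ • (x - b i)) - c • (b i - (b i + (1 - c)⁻¹ • (x - b i)))
        = (x - b i) - ((1 - c)⁻¹ - c * (1 - c)⁻¹) • (x - b i) := by
        rw [sub_smul, mul_smul]
        simp only [sub_add_cancel_left, smul_neg]
        abel
      rw [h3, one_smul, sub_self, sub_eq_zero] at this
      exact this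

/-- The divergence theorem for `(x - b i) ζ(x)` on a simplex, if `ζ` vanishes on the facet opposite
to the vertex `b i`. -/
theorem setIntegral_fderiv_eq_zero [Nontrivial ι] {i : ι} {ζ : E → ℝ} (hζ : ContDiff ℝ 1 ζ)
    (h0 : ∀ x ∈ simplex b, b.coord i x = 0 → ζ x = 0) :
    ∫ x in simplex b, (fderiv ℝ ζ x (x - b i) + finrank ℝ E * ζ x) ∂μ = 0 := by
  set H : ℝ → ℝ := fun s => s ^ finrank ℝ E *
    ∫ x in simplex b, ζ (AffineMap.homothety (b i) s x) ∂μ with hH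
  have hder := hasDerivAt_setIntegral_homothety μ (isCompact_simplex b) (b i) hζ
  rw [← hH] at hder
  obtain ⟨L, hL⟩ := (isCompact_simplex b).exists_bound_of_continuousOn
    (hζ.continuous_fderiv (by simp)).continuousOn
  obtain ⟨R, hR⟩ := (isCompact_simplex b).isBounded.exists_norm_le
  have hne : b i ∈ simplex b := subset_convexHull ℝ _ (mem_range_self i)
  have hL0 : 0 ≤ L := (norm_nonneg _).trans (hL _ hne)
  have hR0 : 0 ≤ R := (norm_nonneg _).trans (hR _ hne)
  -- Since `ζ` vanishes on the facet and is Lipschitz on the simplex, it is bounded by a multiple of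
  -- the distance to the facet along rays from `b i`.
  have hζb : ∀ x ∈ simplex b, ‖ζ x‖ ≤ L * (2 * R) * b.coord i x := by
    intro x hx
    obtain ⟨y, hy, hy0, hxy⟩ := exists_mem_facet b (i := i) hx
    have := (convex_simplex b).norm_image_sub_le_of_norm_fderiv_le (𝕜 := ℝ) (f := ζ)
      (fun z _ => (hζ.differentiable (by simp)) z) hL hy hx
    rw [h0 y hy hy0, sub_zero, hxy, norm_smul, Real.norm_of_nonneg ((mem_simplex b).1 hx i)] at this
    refine this.trans ?_
    have h3 : ‖b i - y‖ ≤ 2 * R := (norm_sub_le _ _).trans (by linarith [hR _ hne, hR _ hy])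
    have h4 := (mem_simplex b).1 hx i
    calc L * (b.coord i x * ‖b i - y‖) ≤ L * (b.coord i x * (2 * R)) := by gcongr
      _ = _ := by ring
  -- On the removed layer `|ζ|` is of order `1 - s`. That cancels the denominator of the difference
  -- quotient, and the volume `1 - s ^ n` of the layer still tends to zero.
  have hslope : ∀ s ∈ Ioo (0 : ℝ) 1, ‖(s - 1)⁻¹ * (H s - H 1)‖ ≤
      L * (2 * R) * ((1 - s ^ finrank ℝ E) * μ.real (simplex b)) := by
    intro s hs
    have h1 := setIntegral_sub_homothety μ b (i := i) hs.1 hs.2.le hζ.continuous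
    have h2 : H 1 = ∫ x in simplex b, ζ x ∂μ := by simp [hH]
    have h3 : ‖∫ x in simplex b \ AffineMap.homothety (b i) s '' simplex b, ζ x ∂μ‖ ≤
        (L * (2 * R) * (1 - s)) *
          μ.real (simplex b \ AffineMap.homothety (b i) s '' simplex b) := by
      refine norm_setIntegral_le_of_norm_le_const ?_ ?_
      · exact (measure_mono sdiff_subset).trans_lt (isCompact_simplex b).measure_lt_top
      · intro x hx
        refine (hζb x hx.1).trans ?_
        have : b.coord i x ≤ 1 - s := by
          by_contra! hlt
          exact hx.2 ((mem_image_homothety_simplex b hs.1).2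
            ⟨fun j _ => (mem_simplex b).1 hx.1 j, hlt.le⟩)
        gcongr
    rw [measureReal_simplex_diff_homothety μ b hs.1 hs.2.le, ← h1, ← h2] at h3
    have h4 : 0 < 1 - s := by linarith [hs.2]
    rw [norm_mul, norm_sub_rev (H s), norm_inv, norm_sub_rev, Real.norm_of_nonneg h4.le]
    rw [inv_mul_le_iff₀ h4]
    linarith
  have ht : Filter.Tendsto (slope H 1) (𝓝[<] 1)
      (𝓝 (∫ x in simplex b, (fderiv ℝ ζ x (x - b i) + finrank ℝ E * ζ x) ∂μ)) :=
    (hasDerivAt_iff_tendsto_slope.1 hder).mono_left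
      (nhdsWithin_mono _ (fun x hx => ne_of_lt hx))
  refine tendsto_nhds_unique ht ?_
  have hb : Filter.Tendsto (fun s : ℝ => L * (2 * R) *
      ((1 - s ^ finrank ℝ E) * μ.real (simplex b))) (𝓝[<] 1) (𝓝 0) := by
    have : Continuous (fun s : ℝ => L * (2 * R) *
      ((1 - s ^ finrank ℝ E) * μ.real (simplex b))) := by fun_prop
    simpa using (this.tendsto 1).mono_left nhdsWithin_le_nhds
  refine squeeze_zero_norm' ?_ hb
  filter_upwards [Ioo_mem_nhdsLT (show (0 : ℝ) < 1 by norm_num)] with s hs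
  have := hslope s hs
  rwa [slope_def_field, div_eq_inv_mul]

/-- Up to a factor, the mean value of `η` over the facet opposite to `b i`, see
`facetMean_congr`. -/
noncomputable def facetMean {ι : Type*} (b : AffineBasis ι ℝ E) (i : ι) (η : E → ℝ) : ℝ :=
  (μ.real (simplex b))⁻¹ * ∫ x in simplex b, (fderiv ℝ η x (x - b i) + finrank ℝ E * η x) ∂μ

theorem setIntegral_eq_facetMean (i : ι) (η : E → ℝ) :
    ∫ x in simplex b, (fderiv ℝ η x (x - b i) + finrank ℝ E * η x) ∂μ
      = μ.real (simplex b) * facetMean μ b i η := by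
  rw [facetMean, mul_inv_cancel_left₀ (measureReal_simplex_pos μ b).ne']

theorem facetMean_eq_zero [Nontrivial ι] {i : ι} {ζ : E → ℝ} (hζ : ContDiff ℝ 1 ζ)
    (h0 : ∀ x ∈ simplex b, b.coord i x = 0 → ζ x = 0) : facetMean μ b i ζ = 0 := by
  rw [facetMean, setIntegral_fderiv_eq_zero μ b hζ h0, mul_zero]

/-- The divergence theorem for `η - ζ` makes the difference vanish, so the volume expression depends
only on values on the facet and can replace a surface integral. -/
theorem facetMean_congr [Nontrivial ι] {i : ι} {η ζ : E → ℝ} (hη : ContDiff ℝ 1 η)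
    (hζ : ContDiff ℝ 1 ζ) (h : ∀ x ∈ simplex b, b.coord i x = 0 → η x = ζ x) :
    facetMean μ b i η = facetMean μ b i ζ := by
  have h0 := setIntegral_fderiv_eq_zero μ b (i := i) (hη.sub hζ)
    (fun x hx hx0 => sub_eq_zero.2 (h x hx hx0))
  have h1 : ∀ x, fderiv ℝ (fun x => η x - ζ x) x = fderiv ℝ η x - fderiv ℝ ζ x := fun x =>
    fderiv_fun_sub (hη.differentiable (by simp) x) (hζ.differentiable (by simp) x)
  have hi : ∀ θ : E → ℝ, ContDiff ℝ 1 θ → IntegrableOn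
      (fun x => fderiv ℝ θ x (x - b i) + finrank ℝ E * θ x) (simplex b) μ := by
    intro θ hθ
    have := hθ.continuous_fderiv (by simp)
    have := hθ.continuous
    exact Continuous.continuousOn (by fun_prop) |>.integrableOn_compact (isCompact_simplex b)
  rw [facetMean, facetMean, ← sub_eq_zero, ← mul_sub, ← integral_sub (hi η hη) (hi ζ hζ)]
  refine mul_eq_zero_of_right _ ?_
  rw [← h0]
  congr 1
  ext x
  change _ = fderiv ℝ (fun x => η x - ζ x) x (x - b i) + _ * (η x - ζ x)
  rw [h1, sub_apply]
  ring

/-- The mean value of a barycentric coordinate over the simplex. -/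
theorem setIntegral_coord [Nontrivial ι] (i : ι) :
    ∫ x in simplex b, b.coord i x ∂μ = μ.real (simplex b) / (finrank ℝ E + 1) := by
  set l : E →L[ℝ] ℝ := coordL b i
  have hc : ∀ x, b.coord i x = l (x - b i) + 1 := fun x => by
    rw [coordL_sub, b.coord_apply_eq]; ring
  have hs : (b.coord i : E → ℝ) = fun x => l (x - b i) + 1 := funext hc
  have hsm : ContDiff ℝ 1 (b.coord i : E → ℝ) := by rw [hs]; fun_prop
  have hf : ∀ x, fderiv ℝ (b.coord i : E → ℝ) x (x - b i) = b.coord i x - 1 := by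
    intro x
    have : HasFDerivAt (b.coord i : E → ℝ) l x := by
      rw [hs]
      simpa using (l.hasFDerivAt.comp x ((hasFDerivAt_id x).sub_const (b i))).add_const 1
    rw [this.fderiv, hc]; ring
  -- With the barycentric coordinate itself as `ζ`, the integrand is `(n + 1) λ_i - 1`, which
  -- determines the integral of `λ_i`.
  have h := setIntegral_fderiv_eq_zero μ b (i := i) hsm (fun _ _ h => h)
  have hi : IntegrableOn (b.coord i : E → ℝ) (simplex b) μ :=
    hsm.continuous.continuousOn.integrableOn_compact (isCompact_simplex b)
  have h1 : ∀ x, fderiv ℝ (b.coord i : E → ℝ) x (x - b i) + finrank ℝ E * b.coord i x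
      = (finrank ℝ E + 1) * b.coord i x - 1 := by intro x; rw [hf]; ring
  simp_rw [h1] at h
  rw [integral_sub (hi.const_mul _) (by
    simp only [integrable_const_iff]
    exact Or.inr ⟨by simpa using (isCompact_simplex b).measure_lt_top⟩), integral_const_mul] at h
  simp only [integral_const, smul_eq_mul, mul_one, MeasurableSet.univ, measureReal_restrict_apply,
    univ_inter] at h
  rw [eq_div_iff (by positivity)]
  linarith

/-- The mean value over the facet is positive for nonnegative functions that are bounded below
near a point of the facet. -/
theorem facetMean_pos {i : ι} (hn : finrank ℝ E ≠ 0) {η : E → ℝ} (hη : ContDiff ℝ 1 η)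
    (h0 : ∀ x, 0 ≤ η x) {c : E} (hc : c ∈ simplex b) (hci : b.coord i c = 0)
    (h1 : ∀ᶠ x in 𝓝 c, 1 ≤ η x) : 0 < facetMean μ b i η := by
  set n := finrank ℝ E
  have hV := measureReal_simplex_pos μ b
  refine mul_pos (inv_pos.2 hV) ?_
  set H : ℝ → ℝ := fun s => s ^ n *
    ∫ x in simplex b, η (AffineMap.homothety (b i) s x) ∂μ with hH
  have hder := hasDerivAt_setIntegral_homothety μ (isCompact_simplex b) (b i) hη
  rw [← hH] at hder
  obtain ⟨r, hr, hball⟩ := Metric.eventually_nhds_iff.1 h1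
  obtain ⟨R, hR0, hR⟩ : ∃ R, 0 < R ∧ ∀ x ∈ simplex b, ‖x - c‖ ≤ R := by
    obtain ⟨R, hR⟩ := (isCompact_simplex b).isBounded.exists_norm_le
    refine ⟨R + R + 1, ?_, fun x hx => ?_⟩
    · have := (norm_nonneg _).trans (hR c hc); positivity
    · linarith [norm_sub_le x c, hR x hx, hR c hc]
  obtain ⟨ρ, hρ0, hρ1, hρr⟩ : ∃ ρ : ℝ, 0 < ρ ∧ ρ ≤ 1 ∧ ρ * R < r := by
    refine ⟨min 1 (r / (2 * R)), by positivity, min_le_left _ _, ?_⟩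
    calc min 1 (r / (2 * R)) * R ≤ r / (2 * R) * R := by gcongr; exact min_le_right _ _
      _ = r / 2 := by field_simp
      _ < r := by linarith
  have hbound : ∀ s ∈ Ioo (1 - ρ) 1, ρ ^ n * μ.real (simplex b) / ρ ≤ slope H 1 s := by
    intro s hs
    have hs0 : 0 < s := by linarith [hs.1]
    set t := (1 - s) / ρ with ht
    have ht0 : 0 < t := div_pos (by linarith [hs.2]) hρ0
    have ht1 : t < 1 := by rw [ht, div_lt_one hρ0]; linarith [hs.1]
    -- As `c` lies on the facet, contraction by `ρ` about `c` multiplies the `i`-th coordinate by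
    -- `ρ`. It moves the layer of thickness `t = (1 - s) / ρ` into the layer of thickness `1 - s`,
    -- and into the ball around `c` on which `1 ≤ η`. The volume of `B` is of order `1 - s`, which
    -- bounds the slope from below.
    set B := AffineMap.homothety c ρ ''
      (simplex b \ AffineMap.homothety (b i) (1 - t) '' simplex b) with hB
    have hBs : B ⊆ simplex b \ AffineMap.homothety (b i) s '' simplex b := by
      rintro _ ⟨x, ⟨hx, hx'⟩, rfl⟩
      refine ⟨?_, fun hmem => ?_⟩
      · rw [mem_simplex] at hx hc ⊢
        intro j
        rw [coord_homothety]
        exact add_nonneg (mul_nonneg (by linarith) (hc j)) (mul_nonneg hρ0.le (hx j))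
      · rw [mem_image_homothety_simplex b hs0, coord_homothety, hci] at hmem
        apply hx'
        rw [mem_image_homothety_simplex b (by linarith)]
        refine ⟨fun j _ => (mem_simplex b).1 hx j, ?_⟩
        rw [sub_sub_cancel, ht, div_le_iff₀ hρ0]
        linarith [hmem.2]
    have hBη : ∀ x ∈ B, 1 ≤ η x := by
      rintro _ ⟨x, ⟨hx, _⟩, rfl⟩
      apply hball
      rw [homothety_eq, dist_eq_norm, add_sub_cancel_left, norm_smul, Real.norm_of_nonneg hρ0.le]
      exact (mul_le_mul_of_nonneg_left (hR x hx) hρ0.le).trans_lt hρr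
    have hBvol : μ.real B = ρ ^ n * ((1 - (1 - t) ^ n) * μ.real (simplex b)) := by
      rw [← measureReal_simplex_diff_homothety μ b (i := i) (by linarith) (by linarith), hB,
        Measure.real, Measure.addHaar_image_homothety, ENNReal.toReal_mul,
        ENNReal.toReal_ofReal (abs_nonneg _), abs_of_nonneg (by positivity)]
      rfl
    have hfin : μ (simplex b \ AffineMap.homothety (b i) s '' simplex b) ≠ ⊤ :=
      ((measure_mono sdiff_subset).trans_lt (isCompact_simplex b).measure_lt_top).ne
    have hint : IntegrableOn η (simplex b \ AffineMap.homothety (b i) s '' simplex b) μ :=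
      (hη.continuous.continuousOn.integrableOn_compact (isCompact_simplex b)).mono_set sdiff_subset
    have hge : μ.real B ≤ ∫ x in simplex b \ AffineMap.homothety (b i) s '' simplex b, η x ∂μ := by
      have hBm : MeasurableSet B := by
        have hcl : IsClosedMap (AffineMap.homothety c ρ : E → E) := by
          have := (Homeomorph.addLeft (c - ρ • c)).isClosedMap.comp
            ((Homeomorph.smulOfNeZero ρ hρ0.ne' : E ≃ₜ E).isClosedMap)
          convert! this using 1
          ext x
          simp [homothety_eq, smul_sub]; abel
        have hinj : Function.Injective (AffineMap.homothety c ρ : E → E) := by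
          intro x y h
          simpa [homothety_eq, hρ0.ne'] using h
        have hcont : Continuous (AffineMap.homothety c ρ : E → E) :=
          AffineMap.homothety_continuous c ρ
        exact (Topology.IsClosedEmbedding.of_continuous_injective_isClosedMap hcont hinj
          hcl).measurableEmbedding.measurableSet_image.2
            ((isCompact_simplex b).measurableSet.diff (measurableSet_image_homothety_simplex b _ _))
      calc μ.real B = ∫ x in B, (1 : ℝ) ∂μ := by simp
        _ ≤ ∫ x in B, η x ∂μ := by
          refine setIntegral_mono_on ?_ (hint.mono_set hBs) hBm hBη
          exact integrableOn_const (measure_ne_top_of_subset hBs hfin)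
        _ ≤ _ := setIntegral_mono_set hint (Filter.Eventually.of_forall h0)
          (Filter.Eventually.of_forall hBs)
    rw [← setIntegral_sub_homothety μ b hs0 hs.2.le hη.continuous, hBvol] at hge
    have hH1 : H 1 = ∫ x in simplex b, η x ∂μ := by simp [hH]
    have hge' : ρ ^ n * ((1 - (1 - t) ^ n) * μ.real (simplex b)) ≤ H 1 - H s := by
      rw [hH1]; exact hge
    have hpow : t ≤ 1 - (1 - t) ^ n := by
      have := pow_le_of_le_one (by linarith : 0 ≤ 1 - t) (by linarith) hn
      linarith
    have h1s : 0 < 1 - s := by linarith [hs.2]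
    rw [slope_comm, slope_def_field, le_div_iff₀ h1s]
    calc ρ ^ n * μ.real (simplex b) / ρ * (1 - s) = ρ ^ n * (t * μ.real (simplex b)) := by
          rw [ht]; ring
      _ ≤ ρ ^ n * ((1 - (1 - t) ^ n) * μ.real (simplex b)) := by gcongr
      _ ≤ _ := hge'
  have ht : Filter.Tendsto (slope H 1) (𝓝[<] 1)
      (𝓝 (∫ x in simplex b, (fderiv ℝ η x (x - b i) + finrank ℝ E * η x) ∂μ)) :=
    (hasDerivAt_iff_tendsto_slope.1 hder).mono_left
      (nhdsWithin_mono _ (fun x hx => ne_of_lt hx))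
  refine lt_of_lt_of_le (show 0 < ρ ^ n * μ.real (simplex b) / ρ by positivity)
    (ge_of_tendsto ht ?_)
  filter_upwards [Ioo_mem_nhdsLT (show 1 - ρ < (1 : ℝ) by linarith)] with s hs
  exact hbound s hs

section FacetSwap

variable {ι' : Type*} [Fintype ι'] (b' : AffineBasis ι' ℝ E)

/-- The map `x ↦ x + λ_i(x) (b' (e i) - b i)` is the affine map that fixes the common facet and
takes one opposite vertex to the other, hence it preserves barycentric coordinates. -/
theorem coord_facetSwap {i : ι} (e : ι ≃ ι') (h : ∀ j, j ≠ i → b' (e j) = b j) (j : ι) (x : E) :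
    b'.coord (e j) (x + b.coord i x • (b' (e i) - b i)) = b.coord j x := by
  classical
  have h1 : x + b.coord i x • (b' (e i) - b i)
      = Finset.univ.affineCombination ℝ b' (fun k => b.coord (e.symm k) x) := by
    have hx := b.linear_combination_coord_eq_self x
    rw [Finset.affineCombination_eq_linear_combination _ _ _ (by
      rw [Equiv.sum_comp e.symm (fun k => b.coord k x)]; exact b.sum_coord_apply_eq_one x)]
    rw [← Equiv.sum_comp e]
    simp only [Equiv.symm_apply_apply]
    rw [← Finset.add_sum_erase _ _ (Finset.mem_univ i)] at hx ⊢
    rw [Finset.sum_congr rfl (fun k hk => by rw [h k (Finset.ne_of_mem_erase hk)] :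
      ∀ k ∈ Finset.univ.erase i, b.coord k x • b' (e k) = b.coord k x • b k)]
    nth_rewrite 1 [← hx]
    rw [smul_sub]; abel
  rw [h1, b'.coord_apply_combination_of_mem (Finset.mem_univ _) (by
      rw [Equiv.sum_comp e.symm (fun k => b.coord k x)]; exact b.sum_coord_apply_eq_one x)]
  simp

/-- Two simplices with a common facet give it the same mean. The facet swap has constant Jacobian,
which cancels against the ratio of the volumes, and it is the identity on the facet, so
`facetMean_congr` replaces `η ∘ A` by `η`. -/
theorem facetMean_eq_of_equiv [Nontrivial ι] {i : ι} (e : ι ≃ ι')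
    (h : ∀ j, j ≠ i → b' (e j) = b j) {η : E → ℝ} (hη : ContDiff ℝ 1 η) :
    facetMean μ b' (e i) η = facetMean μ b i η := by
  set w := b' (e i) - b i with hw
  set l : E →L[ℝ] ℝ := coordL b i
  have hc : ∀ x, b.coord i x = l (x - b i) + 1 := fun x => by
    rw [coordL_sub, b.coord_apply_eq]; ring
  set A : E → E := fun x => x + b.coord i x • w with hA
  set A' : E →L[ℝ] E := ContinuousLinearMap.id ℝ E + l.smulRight w with hA'
  have hAsm : ContDiff ℝ 1 A := by
    have : A = fun x => x + (l (x - b i) + 1) • w := by ext x; rw [hA]; simp only [hc]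
    rw [this]; fun_prop
  have hAd : ∀ x, HasFDerivAt A A' x := by
    intro x
    have h1 : HasFDerivAt (fun x => b.coord i x) l x := by
      simp only [hc]
      simpa using (l.hasFDerivAt.comp x ((hasFDerivAt_id x).sub_const (b i))).add_const 1
    exact (hasFDerivAt_id x).add (h1.smul_const w)
  have hcoord := coord_facetSwap b b' e h
  have h' : ∀ j, j ≠ e i → b (e.symm j) = b' j := by
    intro j hj
    rw [← h (e.symm j) (by rintro rfl; simp at hj), Equiv.apply_symm_apply]
  have hcoord' := coord_facetSwap (i := e i) b' b e.symm h'
  have himg : A '' simplex b = simplex b' := by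
    ext y
    constructor
    · rintro ⟨x, hx, rfl⟩
      rw [mem_simplex] at hx ⊢
      intro j
      have := hcoord (e.symm j) x
      rw [Equiv.apply_symm_apply] at this
      rw [hA]; simp only [hw, this, hx]
    · intro hy
      rw [mem_simplex] at hy
      refine ⟨y + b'.coord (e i) y • (b (e.symm (e i)) - b' (e i)), ?_, ?_⟩
      · rw [mem_simplex]
        intro j
        have := hcoord' (e j) y
        rw [Equiv.symm_apply_apply] at this
        rw [this]; exact hy _
      · apply b'.ext_elem
        intro j
        obtain ⟨j, rfl⟩ := e.surjective j
        rw [hA]; simp only [hw, hcoord]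
        have := hcoord' (e j) y
        rwa [Equiv.symm_apply_apply] at this
  have hinj : InjOn A (simplex b) := by
    intro x _ y _ hxy
    apply b.ext_elem
    intro j
    rw [← hcoord j x, ← hcoord j y]
    exact congrArg _ hxy
  have hcv : ∀ f : E → ℝ, ∫ x in simplex b', f x ∂μ = |A'.det| * ∫ x in simplex b, f (A x) ∂μ := by
    intro f
    rw [← himg, integral_image_eq_integral_abs_det_fderiv_smul μ
      (isCompact_simplex b).measurableSet (fun x _ => (hAd x).hasFDerivWithinAt) hinj]
    simp only [smul_eq_mul]
    rw [integral_const_mul]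
  have hvol : μ.real (simplex b') = |A'.det| * μ.real (simplex b) := by
    have := hcv (fun _ => 1)
    simpa using this
  have hdet : |A'.det| ≠ 0 := by
    intro h0
    have := measureReal_simplex_pos μ b'
    rw [hvol, h0, zero_mul] at this
    exact lt_irrefl _ this
  have hmid : facetMean μ b' (e i) η = facetMean μ b i (η ∘ A) := by
    rw [facetMean, facetMean, hcv, hvol, mul_inv, mul_mul_mul_comm, inv_mul_cancel₀ hdet, one_mul]
    congr 2
    ext x
    have hd : fderiv ℝ (η ∘ A) x = (fderiv ℝ η (A x)).comp A' :=
      (((hη.differentiable (by simp)) (A x)).hasFDerivAt.comp x (hAd x)).fderiv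
    rw [hd, ContinuousLinearMap.comp_apply]
    -- The swap sends `b i` to `b' (e i)`, so the radial field about one apex is carried to the
    -- radial field about the other.
    have : A' (x - b i) = A x - b' (e i) := by
      simp only [hA', hA, hw, hc, add_apply, ContinuousLinearMap.id_apply,
        ContinuousLinearMap.smulRight_apply, add_smul, one_smul]
      abel
    rw [this]; rfl
  rw [hmid]
  refine facetMean_congr μ b (hη.comp hAsm) hη ?_
  intro x _ hx0
  simp [hA, hx0]

end FacetSwap

end SimplexCalculus
end DiscreteDuality

/-! ### Geometry of a triangulation of a Lipschitz domain -/

namespace DiscreteDuality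

/-- The closure of a Lipschitz domain has no additional interior points. -/
theorem IsBoundedLipschitzDomain.interior_closure_subset {d : ℕ} {Ω : Set (Rd d)}
    (hΩ : IsBoundedLipschitzDomain Ω) : interior (closure Ω) ⊆ Ω := by
  intro x hx
  by_contra hxΩ
  have hfr : x ∈ frontier Ω := by
    rw [hΩ.isOpen.frontier_eq]; exact ⟨interior_subset hx, hxΩ⟩
  obtain ⟨ν, hν, K, γ, hγ, hloc⟩ := hΩ.lipschitz_boundary x hfr
  have hνν : inner ℝ ν ν = (1 : ℝ) := by rw [real_inner_self_eq_norm_sq, hν]; norm_num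
  have hle : inner ℝ ν x ≤ γ (x - inner ℝ ν x • ν) := by
    by_contra! hlt
    exact hxΩ (hloc.self_of_nhds.2 hlt)
  have ht : Filter.Tendsto (fun t : ℝ => x - t • ν) (𝓝[>] 0) (𝓝 x) := by
    have : Continuous (fun t : ℝ => x - t • ν) := by fun_prop
    simpa using (this.tendsto 0).mono_left nhdsWithin_le_nhds
  have h1 : ∀ᶠ t in 𝓝[>] (0 : ℝ), x - t • ν ∈ closure Ω :=
    ht.eventually (mem_interior_iff_mem_nhds.1 hx)
  have h2 := ht.eventually hloc.eventually_nhds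
  obtain ⟨t, ⟨h1, h2⟩, h3⟩ := ((h1.and h2).and self_mem_nhdsWithin).exists
  have h3 : 0 < t := h3
  have hcont : Continuous (fun y : Rd d => γ (y - inner ℝ ν y • ν) - inner ℝ ν y) := by
    have := hγ.continuous
    fun_prop
  -- Moving by `-t ν` lowers the height and keeps the other coordinates, so `x - t ν` is strictly
  -- below the graph and has a neighbourhood without points of `Ω`. This contradicts its being in
  -- the closure.
  have hpos : 0 < γ (x - t • ν - inner ℝ ν (x - t • ν) • ν) - inner ℝ ν (x - t • ν) := by
    have : x - t • ν - inner ℝ ν (x - t • ν) • ν = x - inner ℝ ν x • ν := by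
      rw [inner_sub_right, inner_smul_right, hνν, mul_one, sub_smul]; abel
    rw [this, inner_sub_right, inner_smul_right, hνν]; linarith
  have h4 := (hcont.tendsto (x - t • ν)).eventually (lt_mem_nhds hpos)
  obtain ⟨y, hyΩ, hy⟩ := (mem_closure_iff_frequently.1 h1).and_eventually (h2.and h4) |>.exists
  have := hy.1.1 hyΩ
  linarith [hy.2]

theorem affineMap_barycenter {d : ℕ} {F : Type*} [AddCommGroup F] [Module ℝ F]
    (f : Rd d →ᵃ[ℝ] F) {S : Finset (Rd d)}
    (hS : S.Nonempty) : f (barycenter S) = (S.card : ℝ)⁻¹ • ∑ v ∈ S, f v := by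
  have h : ∀ x, f x = f.linear x + f 0 := fun x => congrFun f.decomp x
  have hc : (S.card : ℝ) ≠ 0 := by exact_mod_cast hS.card_pos.ne'
  rw [h, barycenter, map_smul, map_sum, Finset.sum_congr rfl (fun v _ => h v),
    Finset.sum_add_distrib, Finset.sum_const, smul_add, ← Nat.cast_smul_eq_nsmul ℝ, smul_smul,
    inv_mul_cancel₀ hc, one_smul]

theorem affineMap_eq_sum_coord {E F ι : Type*} [AddCommGroup E] [Module ℝ E] [AddCommGroup F]
    [Module ℝ F] [Fintype ι] (b : AffineBasis ι ℝ E) (f : E →ᵃ[ℝ] F) (x : E) :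
    f x = ∑ i, b.coord i x • f (b i) := by
  have h : ∀ x, f x = f.linear x + f 0 := fun x => congrFun f.decomp x
  conv_lhs => rw [← b.linear_combination_coord_eq_self x]
  rw [h, map_sum]
  simp_rw [map_smul, fun i => h (b i), smul_add]
  rw [Finset.sum_add_distrib, ← Finset.sum_smul, b.sum_coord_apply_eq_one, one_smul]

namespace Triangulation

variable {d : ℕ} {Ω : Set (Rd d)} (𝒯 : Triangulation Ω)

/-- The vertices of an element as an affine basis. -/
noncomputable def basis (T : 𝒯.Element) : AffineBasis T.1 ℝ (Rd d) :=
  ⟨fun v => v.1, 𝒯.indep T.2.1, by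
    refine (𝒯.indep T.2.1).affineSpan_eq_top_iff_card_eq_finrank_add_one.2 ?_
    simpa using T.2.2⟩

@[simp]
theorem basis_apply (T : 𝒯.Element) (v : T.1) : 𝒯.basis T v = v.1 := rfl

theorem nontrivial_vertices (hd : d ≠ 0) (T : 𝒯.Element) : Nontrivial T.1 := by
  rw [← Fintype.one_lt_card_iff_nontrivial, Fintype.card_coe, T.2.2]; omega

theorem cell_eq_simplex (T : 𝒯.Element) : cell T.1 = simplex (𝒯.basis T) := by
  rw [cell, simplex]
  congr 1
  ext x
  simp

theorem mem_cell (T : 𝒯.Element) {x : Rd d} :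
    x ∈ cell T.1 ↔ ∀ v, 0 ≤ (𝒯.basis T).coord v x := by
  rw [cell_eq_simplex, mem_simplex]

theorem isCompact_cell (S : Finset (Rd d)) : IsCompact (cell S) :=
  S.finite_toSet.isCompact_convexHull ℝ

theorem coord_coe {T : 𝒯.Element} {v : T.1} {w : Rd d} (hw : w ∈ T.1) :
    (𝒯.basis T).coord v w = if w = v then 1 else 0 := by
  classical
  have := (𝒯.basis T).coord_apply v ⟨w, hw⟩
  simp only [basis_apply] at this
  rw [this]
  by_cases h : w = v
  · simp [h]
  · rw [if_neg h, if_neg]; rintro rfl; exact h rfl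

theorem coord_barycenter {T : 𝒯.Element} {v : T.1} {S : Finset (Rd d)} (hS : S.Nonempty)
    (hST : S ⊆ T.1) :
    (𝒯.basis T).coord v (barycenter S) = if v.1 ∈ S then (S.card : ℝ)⁻¹ else 0 := by
  classical
  rw [affineMap_barycenter _ hS, Finset.sum_congr rfl (fun w hw => 𝒯.coord_coe (hST hw))]
  simp

theorem mem_cell_of_subset {T : 𝒯.Element} {S : Finset (Rd d)} (hST : S ⊆ T.1) {x : Rd d} :
    x ∈ cell S ↔ x ∈ cell T.1 ∧ ∀ v : T.1, v.1 ∉ S → (𝒯.basis T).coord v x = 0 := by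
  classical
  constructor
  · intro hx
    refine ⟨convexHull_mono (by exact_mod_cast hST) hx, fun v hv => ?_⟩
    have hconv : Convex ℝ ((𝒯.basis T).coord v ⁻¹' {0}) :=
      (convex_singleton (0 : ℝ)).affine_preimage _
    refine convexHull_min ?_ hconv hx
    intro w hw
    rw [Set.mem_preimage, 𝒯.coord_coe (hST hw), if_neg, Set.mem_singleton_iff]
    rintro rfl; exact hv hw
  · rintro ⟨hx, h0⟩
    rw [mem_cell] at hx
    have hsum : ∀ {F : Type} [AddCommGroup F] (g : T.1 → F), (∀ v, v.1 ∉ S → g v = 0) →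
        ∑ v, g v = ∑ v ∈ Finset.univ.filter (fun v : T.1 => v.1 ∈ S), g v := by
      intro F _ g hg
      rw [Finset.sum_filter_of_ne]
      intro v _ hv
      by_contra h
      exact hv (hg v h)
    have h1 := (𝒯.basis T).sum_coord_apply_eq_one x
    have h2 := (𝒯.basis T).linear_combination_coord_eq_self x
    rw [hsum _ h0] at h1
    rw [hsum _ (fun v hv => by rw [h0 v hv, zero_smul])] at h2
    rw [← h2]
    refine (convex_convexHull ℝ _).sum_mem (fun v _ => hx v) h1 (fun v hv => ?_)
    exact subset_convexHull ℝ _ (by simpa using hv)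

theorem barycenter_mem_cell {S : Finset (Rd d)} (hS : S.Nonempty) : barycenter S ∈ cell S := by
  rw [barycenter, Finset.smul_sum]
  have hc : (0 : ℝ) < S.card := by exact_mod_cast hS.card_pos
  refine (convex_convexHull ℝ _).sum_mem (fun v _ => (inv_pos.2 hc).le) ?_
    (fun v hv => subset_convexHull ℝ _ hv)
  rw [Finset.sum_const, nsmul_eq_mul, mul_inv_cancel₀ hc.ne']

theorem exists_element {S : Finset (Rd d)} (hS : S ∈ 𝒯.faces) : ∃ T : 𝒯.Element, S ⊆ T.1 := by
  obtain ⟨T, hT, hST, hc⟩ := 𝒯.pure S hS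
  exact ⟨⟨T, hT, hc⟩, hST⟩

theorem Element.eq_of_subset {𝒯 : Triangulation Ω} {T T' : 𝒯.Element} (h : T.1 ⊆ T'.1) :
    T = T' :=
  Subtype.ext (Finset.eq_of_subset_of_card_le h (by rw [T.2.2, T'.2.2]))

theorem mem_cell_inter {S S' : Finset (Rd d)} (hS : S ∈ 𝒯.faces) (hS' : S' ∈ 𝒯.faces) {x : Rd d}
    (hx : x ∈ cell S) (hx' : x ∈ cell S') : x ∈ cell (S.filter (· ∈ S')) := by
  have := 𝒯.inter_subset_convexHull hS hS' ⟨hx, hx'⟩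
  rw [cell]
  convert! this using 2
  ext; simp

/-- A face that contains a relative interior point of another one contains that one. -/
theorem subset_of_mem_cell {T : 𝒯.Element} {S S' : Finset (Rd d)} (hST : S ⊆ T.1)
    (hS' : S' ∈ 𝒯.faces) {x : Rd d} (hx : x ∈ cell T.1) (hx' : x ∈ cell S')
    (hpos : ∀ v : T.1, v.1 ∈ S → (𝒯.basis T).coord v x ≠ 0) : S ⊆ S' := by
  intro v hv
  have h1 := 𝒯.mem_cell_inter T.2.1 hS' hx hx'
  rw [𝒯.mem_cell_of_subset (T := T) (Finset.filter_subset _ _)] at h1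
  by_contra h
  exact hpos ⟨v, hST hv⟩ hv (h1.2 ⟨v, hST hv⟩ (by simp [h]))

theorem subset_of_barycenter_mem {S S' : Finset (Rd d)} (hS : S ∈ 𝒯.faces)
    (hS' : S' ∈ 𝒯.faces) (h : barycenter S ∈ cell S') : S ⊆ S' := by
  obtain ⟨T, hT⟩ := 𝒯.exists_element hS
  have hne := 𝒯.nonempty_of_mem_faces hS
  refine 𝒯.subset_of_mem_cell hT hS' (convexHull_mono (by exact_mod_cast hT)
    (barycenter_mem_cell hne)) h (fun v hv => ?_)
  rw [𝒯.coord_barycenter hne hT, if_pos hv]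
  have : (0 : ℝ) < S.card := by exact_mod_cast hne.card_pos
  positivity

theorem sides_eq_of_barycenter_mem {S S' : Finset (Rd d)} (hS : S ∈ 𝒯.sides)
    (hS' : S' ∈ 𝒯.sides) (h : barycenter S ∈ cell S') : S = S' :=
  Finset.eq_of_subset_of_card_le (𝒯.subset_of_barycenter_mem hS.1 hS'.1 h) (by rw [hS.2, hS'.2])

/-- Within the affine span of `S` the coordinates belonging to vertices outside `S` vanish, and the
others stay positive near the barycenter. This allows a condition on open sides to be tested at
midpoints. -/
theorem barycenter_mem_openCell {S : Finset (Rd d)} (hS : S ∈ 𝒯.faces) :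
    barycenter S ∈ openCell S := by
  obtain ⟨T, hT⟩ := 𝒯.exists_element hS
  have hne := 𝒯.nonempty_of_mem_faces hS
  have hmem : barycenter S ∈ cell S := barycenter_mem_cell hne
  rw [openCell, mem_intrinsicInterior]
  refine ⟨⟨barycenter S, subset_affineSpan ℝ _ hmem⟩, ?_, rfl⟩
  rw [mem_interior_iff_mem_nhds]
  have hU : ∀ᶠ x in 𝓝 (barycenter S), ∀ v : T.1, v.1 ∈ S → 0 < (𝒯.basis T).coord v x := by
    rw [Filter.eventually_all]
    intro v
    by_cases hv : v.1 ∈ S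
    · have hp : 0 < (𝒯.basis T).coord v (barycenter S) := by
        rw [𝒯.coord_barycenter hne hT, if_pos hv]
        have : (0 : ℝ) < S.card := by exact_mod_cast hne.card_pos
        positivity
      filter_upwards [((continuous_barycentric_coord (𝒯.basis T) v).tendsto _).eventually
        (lt_mem_nhds hp)] with x hx _ using hx
    · simp [hv]
  have hU' := (continuous_subtype_val (p := fun x => x ∈ affineSpan ℝ (cell S))).continuousAt
    (x := ⟨barycenter S, subset_affineSpan ℝ _ hmem⟩) |>.tendsto.eventually hU
  filter_upwards [hU'] with x hx
  have h0 : ∀ v : T.1, v.1 ∉ S → (𝒯.basis T).coord v x = 0 := by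
    intro v hv
    -- The subspace `mk' 0 ⊥` of `ℝ` is the single point `0`; its preimage is the zero set of the
    -- coordinate.
    have hle : affineSpan ℝ (cell S) ≤
        (AffineSubspace.mk' (0 : ℝ) ⊥).comap ((𝒯.basis T).coord v) := by
      rw [affineSpan_le]
      intro y hy
      have := ((𝒯.mem_cell_of_subset hT).1 hy).2 v hv
      simp [this]
    have := hle x.2
    simpa using this
  rw [Set.mem_preimage, 𝒯.mem_cell_of_subset hT, mem_cell]
  refine ⟨fun v => ?_, h0⟩
  by_cases hv : v.1 ∈ S
  · exact (hx v hv).le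
  · rw [h0 v hv]

/-- The side of an element opposite to a vertex. -/
noncomputable def side (T : 𝒯.Element) (v : T.1) : Finset (Rd d) :=
  by classical exact T.1.erase v

theorem mem_side {T : 𝒯.Element} {v : T.1} {w : Rd d} : w ∈ 𝒯.side T v ↔ w ≠ v ∧ w ∈ T.1 := by
  simp [side]

theorem side_subset (T : 𝒯.Element) (v : T.1) : 𝒯.side T v ⊆ T.1 := fun _ h => (𝒯.mem_side.1 h).2

theorem card_side (T : 𝒯.Element) (v : T.1) : (𝒯.side T v).card = d := by
  classical
  have : 𝒯.side T v = T.1.erase v := by ext; simp [mem_side]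
  rw [this, Finset.card_erase_of_mem v.2, T.2.2]; rfl

theorem side_nonempty (hd : d ≠ 0) (T : 𝒯.Element) (v : T.1) : (𝒯.side T v).Nonempty := by
  rw [← Finset.card_pos, card_side]; omega

theorem side_mem_sides (hd : d ≠ 0) (T : 𝒯.Element) (v : T.1) : 𝒯.side T v ∈ 𝒯.sides :=
  ⟨𝒯.down_closed T.2.1 (𝒯.side_subset T v) (𝒯.side_nonempty hd T v), 𝒯.card_side T v⟩

theorem exists_eq_side {S : Finset (Rd d)} (hS : S ∈ 𝒯.sides) {T : 𝒯.Element} (hT : S ⊆ T.1) :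
    ∃ v : T.1, S = 𝒯.side T v := by
  classical
  obtain ⟨v, hv⟩ : ∃ v, v ∈ T.1 \ S := by
    rw [← Finset.Nonempty, ← Finset.card_pos, Finset.card_sdiff_of_subset hT, T.2.2, hS.2]; omega
  rw [Finset.mem_sdiff] at hv
  refine ⟨⟨v, hv.1⟩, Finset.eq_of_subset_of_card_le (fun w hw => ?_) ?_⟩
  · rw [mem_side]
    exact ⟨by rintro rfl; exact hv.2 hw, hT hw⟩
  · rw [card_side, hS.2]

theorem mem_cell_side {T : 𝒯.Element} {v : T.1} {x : Rd d} :
    x ∈ cell (𝒯.side T v) ↔ x ∈ cell T.1 ∧ (𝒯.basis T).coord v x = 0 := by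
  rw [𝒯.mem_cell_of_subset (𝒯.side_subset T v)]
  refine and_congr_right fun _ => ⟨fun h => h v (by simp [mem_side]), fun h w hw => ?_⟩
  have : w = v := by
    by_contra hne
    exact hw (𝒯.mem_side.2 ⟨fun h => hne (Subtype.ext h), w.2⟩)
  rw [this, h]

theorem coord_barycenter_side (hd : d ≠ 0) {T : 𝒯.Element} (v w : T.1) :
    (𝒯.basis T).coord w (barycenter (𝒯.side T v)) = if w = v then 0 else (d : ℝ)⁻¹ := by
  rw [𝒯.coord_barycenter (𝒯.side_nonempty hd T v) (𝒯.side_subset T v), card_side]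
  by_cases h : w = v
  · simp [h, mem_side]
  · rw [if_neg h, if_pos (𝒯.mem_side.2 ⟨fun h' => h (Subtype.ext h'), w.2⟩)]

theorem coord_barycenter_element {T : 𝒯.Element} (v : T.1) :
    (𝒯.basis T).coord v (barycenter T.1) = ((d : ℝ) + 1)⁻¹ := by
  rw [𝒯.coord_barycenter ⟨v.1, v.2⟩ subset_rfl, if_pos v.2, T.2.2]; norm_num

theorem cell_subset_closure {S : Finset (Rd d)} (hS : S ∈ 𝒯.faces) : cell S ⊆ closure Ω := by
  rw [← 𝒯.space_eq]
  exact 𝒯.convexHull_subset_space hS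

theorem exists_mem_cell {x : Rd d} (hx : x ∈ closure Ω) : ∃ T : 𝒯.Element, x ∈ cell T.1 := by
  rw [← 𝒯.space_eq, 𝒯.mem_space_iff] at hx
  obtain ⟨S, hS, hx⟩ := hx
  obtain ⟨T, hT⟩ := 𝒯.exists_element hS
  exact ⟨T, convexHull_mono (by exact_mod_cast hT) hx⟩

/-- A bijection between the vertices of two elements with a common side. -/
theorem exists_equiv_of_side_eq {T T' : 𝒯.Element} {v : T.1} {v' : T'.1}
    (h : 𝒯.side T v = 𝒯.side T' v') :
    ∃ e : T.1 ≃ T'.1, e v = v' ∧ ∀ j, j ≠ v → 𝒯.basis T' (e j) = 𝒯.basis T j := by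
  classical
  have h1 : ∀ j : T.1, j ≠ v → j.1 ≠ v'.1 ∧ j.1 ∈ T'.1 := fun j hj =>
    𝒯.mem_side.1 (h ▸ 𝒯.mem_side.2 ⟨fun h' => hj (Subtype.ext h'), j.2⟩)
  have h2 : ∀ j : T'.1, j ≠ v' → j.1 ≠ v.1 ∧ j.1 ∈ T.1 := fun j hj =>
    𝒯.mem_side.1 (h ▸ 𝒯.mem_side.2 ⟨fun h' => hj (Subtype.ext h'), j.2⟩)
  refine ⟨⟨fun j => if hj : j = v then v' else ⟨j.1, (h1 j hj).2⟩,
    fun j => if hj : j = v' then v else ⟨j.1, (h2 j hj).2⟩, fun j => ?_, fun j => ?_⟩, ?_, ?_⟩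
  · by_cases hj : j = v
    · simp [hj]
    · have := (h1 j hj).1
      simp [hj, Subtype.ext_iff, this]
  · by_cases hj : j = v'
    · simp [hj]
    · have := (h2 j hj).1
      simp [hj, Subtype.ext_iff, this]
  · simp
  · intro j hj
    simp [hj]

theorem facetMean_eq_of_side_eq (hd : d ≠ 0) {T T' : 𝒯.Element} {v : T.1} {v' : T'.1}
    (h : 𝒯.side T v = 𝒯.side T' v') {η : Rd d → ℝ} (hη : ContDiff ℝ 1 η) :
    facetMean volume (𝒯.basis T) v η = facetMean volume (𝒯.basis T') v' η := by
  have := 𝒯.nontrivial_vertices hd T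
  obtain ⟨e, rfl, he⟩ := 𝒯.exists_equiv_of_side_eq h
  exact (facetMean_eq_of_equiv volume _ _ e he hη).symm

/-- Both coordinates are affine functions vanishing on the common side, hence proportional;
evaluation at `v'` gives the factor. -/
theorem coord_eq_mul_of_side_eq {T T' : 𝒯.Element} {v : T.1} {v' : T'.1}
    (h : 𝒯.side T v = 𝒯.side T' v') (x : Rd d) :
    (𝒯.basis T).coord v x = (𝒯.basis T').coord v' x * (𝒯.basis T).coord v v'.1 := by
  rw [affineMap_eq_sum_coord (𝒯.basis T') ((𝒯.basis T).coord v) x,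
    Finset.sum_eq_single v' _ (by simp)]
  · rfl
  · intro w _ hw
    have : w.1 ∈ 𝒯.side T v := h ▸ 𝒯.mem_side.2 ⟨fun h' => hw (Subtype.ext h'), w.2⟩
    rw [basis_apply, 𝒯.coord_coe (𝒯.mem_side.1 this).2, if_neg (𝒯.mem_side.1 this).1, smul_zero]

theorem eventually_coord_pos (hd : d ≠ 0) (T : 𝒯.Element) (v : T.1) :
    ∀ᶠ x in 𝓝 (barycenter (𝒯.side T v)), ∀ w, w ≠ v → 0 < (𝒯.basis T).coord w x := by
  rw [Filter.eventually_all]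
  intro w
  by_cases hw : w = v
  · simp [hw]
  · have hp : 0 < (𝒯.basis T).coord w (barycenter (𝒯.side T v)) := by
      rw [𝒯.coord_barycenter_side hd, if_neg hw]
      have : (0 : ℝ) < d := by exact_mod_cast Nat.pos_of_ne_zero hd
      positivity
    filter_upwards [((continuous_barycentric_coord (𝒯.basis T) w).tendsto _).eventually
      (lt_mem_nhds hp)] with x hx _ using hx

/-- Two elements with a common side lie on opposite sides of it. -/
theorem coord_neg_of_side_eq (hd : d ≠ 0) {T T' : 𝒯.Element} (hne : T ≠ T') {v : T.1} {v' : T'.1}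
    (h : 𝒯.side T v = 𝒯.side T' v') : (𝒯.basis T).coord v v'.1 < 0 := by
  by_contra! hge
  rcases hge.eq_or_lt with h0 | hpos
  · have := 𝒯.coord_eq_mul_of_side_eq h v.1
    rw [← h0, mul_zero, 𝒯.coord_coe v.2, if_pos rfl] at this
    exact one_ne_zero this
  -- If `v'` were on the same side as `v`, points slightly off the midpoint towards `v'` would lie
  -- in `T'` and in the interior of `T`, which forces `T = T'`.
  · have ht : Filter.Tendsto
        (fun t : ℝ => AffineMap.homothety (barycenter (𝒯.side T v)) t v'.1) (𝓝[>] 0)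
        (𝓝 (barycenter (𝒯.side T v))) := by
      have : Continuous
        (fun t : ℝ => AffineMap.homothety (barycenter (𝒯.side T v)) t v'.1) := by
        simp only [homothety_eq]; fun_prop
      simpa [homothety_eq] using (this.tendsto 0).mono_left nhdsWithin_le_nhds
    obtain ⟨t, ht1, ht2⟩ := ((ht.eventually (𝒯.eventually_coord_pos hd T v)).and
      (Ioo_mem_nhdsGT (zero_lt_one' ℝ))).exists
    set y := AffineMap.homothety (barycenter (𝒯.side T v)) t v'.1 with hy
    have hyc : ∀ w, 0 < (𝒯.basis T).coord w y := by
      intro w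
      by_cases hw : w = v
      · rw [hw, hy, coord_homothety, 𝒯.coord_barycenter_side hd, if_pos rfl, mul_zero, zero_add]
        exact mul_pos ht2.1 hpos
      · exact ht1 w hw
    have hyT' : y ∈ cell T'.1 := by
      rw [hy, AffineMap.homothety_eq_lineMap]
      refine (convex_convexHull ℝ _).lineMap_mem ?_ (subset_convexHull ℝ _ v'.2)
        ⟨ht2.1.le, ht2.2.le⟩
      rw [h]
      exact (𝒯.mem_cell_side.1 (barycenter_mem_cell (𝒯.side_nonempty hd T' v'))).1
    refine hne (Element.eq_of_subset (𝒯.subset_of_mem_cell subset_rfl T'.2.1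
      ((𝒯.mem_cell T).2 fun w => (hyc w).le) hyT' (fun w _ => (hyc w).ne')))

/-- Two elements on opposite sides of a common side together cover a neighbourhood of its midpoint.
The midpoint is then interior to the closure of `Ω`, and the Lipschitz property puts it in `Ω`. -/
theorem barycenter_mem_of_side_eq (hΩ : IsBoundedLipschitzDomain Ω) (hd : d ≠ 0)
    {T T' : 𝒯.Element} (hne : T ≠ T') {v : T.1} {v' : T'.1}
    (h : 𝒯.side T v = 𝒯.side T' v') : barycenter (𝒯.side T v) ∈ Ω := by
  apply hΩ.interior_closure_subset
  rw [mem_interior_iff_mem_nhds]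
  have h1 := 𝒯.eventually_coord_pos hd T v
  have h2 := 𝒯.eventually_coord_pos hd T' v'
  rw [← h] at h2
  filter_upwards [h1, h2] with x hx hx'
  have hneg := 𝒯.coord_neg_of_side_eq hd hne h
  by_cases hv : 0 ≤ (𝒯.basis T).coord v x
  · refine 𝒯.cell_subset_closure T.2.1 ((𝒯.mem_cell T).2 fun w => ?_)
    by_cases hw : w = v
    · rw [hw]; exact hv
    · exact (hx w hw).le
  · refine 𝒯.cell_subset_closure T'.2.1 ((𝒯.mem_cell T').2 fun w => ?_)
    by_cases hw : w = v'
    · rw [hw]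
      rw [𝒯.coord_eq_mul_of_side_eq h x] at hv
      by_contra! hlt
      exact hv (mul_nonneg_of_nonpos_of_nonpos hlt.le hneg.le)
    · exact (hx' w hw).le

/-- Elements that share a side in the boundary coincide. -/
theorem eq_of_side_eq (hΩ : IsBoundedLipschitzDomain Ω) (hd : d ≠ 0)
    {T T' : 𝒯.Element} {v : T.1} {v' : T'.1} (h : 𝒯.side T v = 𝒯.side T' v')
    (hfr : cell (𝒯.side T v) ⊆ frontier Ω) : T = T' := by
  by_contra hne
  have h1 := 𝒯.barycenter_mem_of_side_eq hΩ hd hne h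
  have h2 := hfr (barycenter_mem_cell (𝒯.side_nonempty hd T v))
  rw [hΩ.isOpen.frontier_eq] at h2
  exact h2.2 h1

/-- For `y` in the relative interior of a side that belongs to `T` only: if `y` were in `Ω`, the
points just beyond the side would be covered by elements. As these are finitely many, one of them
contains such points arbitrarily near `y`, hence `y` itself, hence the side. It must be `T`, on
which the `v`-coordinate is nonnegative. -/
theorem notMem_of_unique {T : 𝒯.Element} {v : T.1}
    (huniq : ∀ T' : 𝒯.Element, 𝒯.side T v ⊆ T'.1 → T' = T) (hΩ : IsOpen Ω) {y : Rd d}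
    (hv : (𝒯.basis T).coord v y = 0) (hw : ∀ w, w ≠ v → 0 < (𝒯.basis T).coord w y) : y ∉ Ω := by
  intro hy
  have ht : Filter.Tendsto (fun t : ℝ => AffineMap.homothety y (-t) v.1) (𝓝[>] 0) (𝓝 y) := by
    have : Continuous (fun t : ℝ => AffineMap.homothety y (-t) v.1) := by
      simp only [homothety_eq]; fun_prop
    simpa [homothety_eq] using (this.tendsto 0).mono_left nhdsWithin_le_nhds
  have hev : ∀ᶠ t in 𝓝[>] (0 : ℝ), ∃ T' : 𝒯.Element, AffineMap.homothety y (-t) v.1 ∈ cell T'.1 :=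
    (ht.eventually (hΩ.mem_nhds hy)).mono fun t ht => 𝒯.exists_mem_cell (subset_closure ht)
  obtain ⟨T', hT'⟩ : ∃ T' : 𝒯.Element, ∃ᶠ t in 𝓝[>] (0 : ℝ),
      AffineMap.homothety y (-t) v.1 ∈ cell T'.1 := by
    by_contra! hcon
    obtain ⟨t, ⟨T', h1⟩, h2⟩ := (hev.and (Filter.eventually_all.2 hcon)).exists
    exact h2 T' h1
  have hyT' : y ∈ cell T'.1 :=
    (isCompact_cell T'.1).isClosed.mem_of_frequently_of_tendsto hT' ht
  have hyT : y ∈ cell T.1 := (𝒯.mem_cell T).2 fun w => by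
    by_cases h : w = v
    · rw [h, hv]
    · exact (hw w h).le
  have hTT' : T' = T := by
    apply huniq
    refine 𝒯.subset_of_mem_cell (𝒯.side_subset T v) T'.2.1 hyT hyT' (fun w hws => ?_)
    exact (hw w (fun h => (𝒯.mem_side.1 hws).1 (congrArg _ h))).ne'
  subst hTT'
  obtain ⟨t, h1, h2⟩ := (hT'.and_eventually self_mem_nhdsWithin).exists
  have h2 : 0 < t := h2
  have h3 := (𝒯.mem_cell T').1 h1 v
  rw [coord_homothety, hv, 𝒯.coord_coe v.2, if_pos rfl] at h3
  linarith

/-- A side whose midpoint is on the boundary is contained in the boundary. -/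
theorem cell_subset_frontier (hΩ : IsBoundedLipschitzDomain Ω) (hd : d ≠ 0)
    {S : Finset (Rd d)} (hS : S ∈ 𝒯.sides)
    (hfr : barycenter S ∈ frontier Ω) : cell S ⊆ frontier Ω := by
  obtain ⟨T, hT⟩ := 𝒯.exists_element hS.1
  obtain ⟨v, rfl⟩ := 𝒯.exists_eq_side hS hT
  rw [hΩ.isOpen.frontier_eq] at hfr
  have huniq : ∀ T' : 𝒯.Element, 𝒯.side T v ⊆ T'.1 → T' = T := by
    intro T' hT'
    obtain ⟨v', hv'⟩ := 𝒯.exists_eq_side hS hT'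
    by_contra hne
    exact hfr.2 (𝒯.barycenter_mem_of_side_eq hΩ hd (Ne.symm hne) hv')
  intro y hy
  -- Points of the closed side are limits of relative interior points on the segment to the
  -- midpoint, and the frontier is closed.
  have ht : Filter.Tendsto
      (fun t : ℝ => AffineMap.homothety y t (barycenter (𝒯.side T v))) (𝓝[>] 0) (𝓝 y) := by
    have : Continuous (fun t : ℝ => AffineMap.homothety y t (barycenter (𝒯.side T v))) := by
      simp only [homothety_eq]; fun_prop
    simpa [homothety_eq] using (this.tendsto 0).mono_left nhdsWithin_le_nhds
  refine isClosed_frontier.mem_of_tendsto ht ?_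
  filter_upwards [Ioo_mem_nhdsGT (zero_lt_one' ℝ)] with t ht
  rw [𝒯.mem_cell_side, mem_cell] at hy
  have hc0 : (𝒯.basis T).coord v (AffineMap.homothety y t (barycenter (𝒯.side T v))) = 0 := by
    rw [coord_homothety, 𝒯.coord_barycenter_side hd, if_pos rfl, hy.2]; simp
  have hcw : ∀ w, w ≠ v →
      0 < (𝒯.basis T).coord w (AffineMap.homothety y t (barycenter (𝒯.side T v))) := by
    intro w hw
    rw [coord_homothety, 𝒯.coord_barycenter_side hd, if_neg hw]
    have hd' : (0 : ℝ) < d := by exact_mod_cast Nat.pos_of_ne_zero hd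
    exact add_pos_of_nonneg_of_pos (mul_nonneg (by linarith [ht.2]) (hy.1 w))
      (mul_pos ht.1 (inv_pos.2 hd'))
  rw [hΩ.isOpen.frontier_eq]
  refine ⟨𝒯.cell_subset_closure T.2.1 ((𝒯.mem_cell T).2 fun w => ?_),
    𝒯.notMem_of_unique huniq hΩ.isOpen hc0 hcw⟩
  by_cases h : w = v
  · rw [h, hc0]
  · exact (hcw w h).le

theorem interior_cell_subset (hΩ : IsBoundedLipschitzDomain Ω) (T : 𝒯.Element) :
    interior (cell T.1) ⊆ Ω :=
  (interior_mono (𝒯.cell_subset_closure T.2.1)).trans hΩ.interior_closure_subset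

theorem mem_interior_cell (T : 𝒯.Element) {x : Rd d} :
    x ∈ interior (cell T.1) ↔ ∀ v, 0 < (𝒯.basis T).coord v x := by
  rw [cell_eq_simplex, simplex, AffineBasis.interior_convexHull]; rfl

/-- The interior of an element meets no other one. -/
theorem eq_of_mem_interior_cell {T T' : 𝒯.Element} {x : Rd d} (hx : x ∈ interior (cell T.1))
    (hx' : x ∈ cell T'.1) : T = T' :=
  Element.eq_of_subset (𝒯.subset_of_mem_cell subset_rfl T'.2.1 (interior_subset hx) hx'
    (fun v _ => ((𝒯.mem_interior_cell T).1 hx v).ne'))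

theorem volume_cell_diff_interior (S : Finset (Rd d)) :
    volume (cell S \ interior (cell S)) = 0 := by
  rw [← (isCompact_cell S).isClosed.frontier_eq]
  exact (convex_convexHull ℝ _).addHaar_frontier volume

theorem volume_cell_diff (hΩ : IsBoundedLipschitzDomain Ω) (T : 𝒯.Element) :
    volume (cell T.1 \ Ω) = 0 :=
  measure_mono_null (Set.sdiff_subset_sdiff_right (𝒯.interior_cell_subset hΩ T))
    (volume_cell_diff_interior T.1)

theorem setIntegral_inter_cell (hΩ : IsBoundedLipschitzDomain Ω) (T : 𝒯.Element) (f : Rd d → ℝ) :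
    ∫ x in Ω ∩ cell T.1, f x = ∫ x in cell T.1, f x := by
  refine setIntegral_congr_set ?_
  refine (Filter.EventuallyLE.antisymm (Filter.Eventually.of_forall fun x hx => hx.2) ?_)
  have h := 𝒯.volume_cell_diff hΩ T
  rw [ae_le_set]
  refine measure_mono_null ?_ h
  rintro x ⟨hx, hx'⟩
  exact ⟨hx, fun hxΩ => hx' ⟨hxΩ, hx⟩⟩

theorem setIntegral_interior_cell (S : Finset (Rd d)) (f : Rd d → ℝ) :
    ∫ x in interior (cell S), f x = ∫ x in cell S, f x := by
  refine setIntegral_congr_set ?_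
  refine (Filter.EventuallyLE.antisymm (Filter.Eventually.of_forall interior_subset) ?_)
  rw [ae_le_set]
  exact volume_cell_diff_interior S

theorem vol_pos (T : 𝒯.Element) : 0 < 𝒯.vol T := by
  rw [vol, cell_eq_simplex]; exact measureReal_simplex_pos volume _

end Triangulation
end DiscreteDuality

/-! ### Fluxes and distributional divergence of Raviart-Thomas fields -/

namespace DiscreteDuality

/-- Sums over pairs of an element and a side are regrouped by sides: `s` gives the side, `F` the
flux, and `m` a weight depending only on the side. The weights are facet means of test functions or
midpoint values of Crouzeix-Raviart functions. -/
theorem sum_mul_eq_zero_of_fiber {α β : Type*} [Fintype α] [DecidableEq β] (s : α → β)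
    (F m : α → ℝ) (hm : ∀ p q, s p = s q → m p = m q)
    (h : ∀ p, m p = 0 ∨ ∑ q with s q = s p, F q = 0) : ∑ p, F p * m p = 0 := by
  rw [← Finset.sum_fiberwise_of_maps_to (s := Finset.univ) (t := Finset.univ.image s) (g := s)
    (fun p _ => Finset.mem_image_of_mem s (Finset.mem_univ p))]
  refine Finset.sum_eq_zero fun S hS => ?_
  obtain ⟨p, _, rfl⟩ := Finset.mem_image.1 hS
  rw [Finset.sum_congr rfl (g := fun q => F q * m p) (fun q hq => by
    rw [hm q p (Finset.mem_filter.1 hq).2]), ← Finset.sum_mul]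
  rcases h p with h | h <;> simp [h]

namespace Triangulation

variable {d : ℕ} {Ω : Set (Rd d)} (𝒯 : Triangulation Ω)

/-- The pairs of an element and one of its vertices, which stand for the sides as seen from the
elements they belong to. -/
abbrev Facet : Type := Σ T : 𝒯.Element, T.1

/-- The side of an element opposite to the vertex. -/
noncomputable abbrev Facet.side {𝒯 : Triangulation Ω} (p : 𝒯.Facet) : Finset (Rd d) :=
  Triangulation.side 𝒯 p.1 p.2

/-- The coefficient of `x - v` in the field `a T + β T (x - x_T)`, which is a multiple of the outer
normal component of the field on the side opposite to `v`. -/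
noncomputable def fluxCoeff (a : 𝒯.L0 (Rd d)) (β : 𝒯.L0 ℝ) (p : 𝒯.Facet) : ℝ :=
  β p.1 / (d + 1) - coordL (𝒯.basis p.1) p.2 (a p.1)

/-- A multiple of the outer flux through a side. -/
noncomputable def flux (a : 𝒯.L0 (Rd d)) (β : 𝒯.L0 ℝ) (p : 𝒯.Facet) : ℝ :=
  𝒯.vol p.1 * 𝒯.fluxCoeff a β p

open Classical in
/-- The sum of the outer fluxes through a side from all elements that contain it. -/
noncomputable def fluxJump (a : 𝒯.L0 (Rd d)) (β : 𝒯.L0 ℝ) (p : 𝒯.Facet) : ℝ :=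
  ∑ q : 𝒯.Facet with q.side = p.side, 𝒯.flux a β q

theorem sum_coordL (T : 𝒯.Element) (a : Rd d) : ∑ v, coordL (𝒯.basis T) v a = 0 := by
  have h : ∀ v, coordL (𝒯.basis T) v a = (𝒯.basis T).coord v a - (𝒯.basis T).coord v 0 := by
    intro v; rw [← coordL_sub, sub_zero]
  simp only [h]
  rw [Finset.sum_sub_distrib, (𝒯.basis T).sum_coord_apply_eq_one,
    (𝒯.basis T).sum_coord_apply_eq_one, sub_self]

theorem sum_coordL_smul (T : 𝒯.Element) (a : Rd d) :
    ∑ v, coordL (𝒯.basis T) v a • v.1 = a := by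
  have h : ∀ v, coordL (𝒯.basis T) v a = (𝒯.basis T).coord v a - (𝒯.basis T).coord v 0 := by
    intro v; rw [← coordL_sub, sub_zero]
  have h1 := (𝒯.basis T).linear_combination_coord_eq_self a
  have h2 := (𝒯.basis T).linear_combination_coord_eq_self 0
  simp only [basis_apply] at h1 h2
  simp only [h, sub_smul]
  rw [Finset.sum_sub_distrib, h1, h2, sub_zero]

theorem sum_fluxCoeff (a : 𝒯.L0 (Rd d)) (β : 𝒯.L0 ℝ) (T : 𝒯.Element) :
    ∑ v, 𝒯.fluxCoeff a β ⟨T, v⟩ = β T := by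
  simp only [fluxCoeff]
  rw [Finset.sum_sub_distrib, sum_coordL, sub_zero, Finset.sum_const, Finset.card_univ,
    Fintype.card_coe, T.2.2, nsmul_eq_mul]
  push_cast
  field_simp

theorem sum_fluxCoeff_smul (a : 𝒯.L0 (Rd d)) (β : 𝒯.L0 ℝ) (T : 𝒯.Element) (x : Rd d) :
    ∑ v, 𝒯.fluxCoeff a β ⟨T, v⟩ • (x - v.1) = a T + β T • (x - barycenter T.1) := by
  have h1 : ∑ v : T.1, (β T / (d + 1)) • v.1 = β T • barycenter T.1 := by
    rw [← Finset.smul_sum, barycenter, T.2.2, smul_smul, div_eq_mul_inv]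
    push_cast
    congr 1
    exact Finset.sum_coe_sort T.1 (fun v => v)
  simp only [smul_sub]
  rw [Finset.sum_sub_distrib, ← Finset.sum_smul, sum_fluxCoeff]
  simp only [fluxCoeff, sub_smul]
  rw [Finset.sum_sub_distrib, h1, sum_coordL_smul]
  abel

/-- The discrete integration by parts formula on an element. -/
theorem sum_fluxCoeff_mul (hd : d ≠ 0) (a : 𝒯.L0 (Rd d)) (β : 𝒯.L0 ℝ) (T : 𝒯.Element)
    (f : Rd d →ᵃ[ℝ] ℝ) :
    d * ∑ v, 𝒯.fluxCoeff a β ⟨T, v⟩ * f (barycenter (𝒯.side T v))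
      = f.linear (a T) + d * β T * f (barycenter T.1) := by
  have hd' : (d : ℝ) ≠ 0 := by exact_mod_cast hd
  set σ := ∑ w : T.1, f w.1 with hσ
  have hs : ∀ v : T.1, f (barycenter (𝒯.side T v)) = (d : ℝ)⁻¹ * (σ - f v.1) := by
    intro v
    have hsum : ∑ w ∈ 𝒯.side T v, f w = σ - f v.1 := by
      classical
      have : 𝒯.side T v = T.1.erase v := by ext; simp [mem_side]
      rw [this, eq_sub_iff_add_eq, Finset.sum_erase_add _ _ v.2, hσ]
      exact (Finset.sum_coe_sort T.1 (fun v => f v)).symm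
    rw [affineMap_barycenter f (𝒯.side_nonempty hd T v), card_side, hsum, smul_eq_mul]
  have hT : f (barycenter T.1) = ((d : ℝ) + 1)⁻¹ * σ := by
    obtain ⟨v⟩ := (𝒯.basis T).nonempty
    rw [affineMap_barycenter f ⟨v.1, v.2⟩, T.2.2, hσ, smul_eq_mul]
    push_cast
    rw [← Finset.sum_coe_sort T.1 (fun v => f v)]
  have hl : f.linear (a T) = ∑ v : T.1, coordL (𝒯.basis T) v (a T) * f v.1 := by
    have h : ∀ x, f x = f.linear x + f 0 := fun x => congrFun f.decomp x
    conv_lhs => rw [← 𝒯.sum_coordL_smul T (a T), map_sum]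
    simp only [fun v : T.1 => h v.1, map_smul, smul_eq_mul, mul_add]
    rw [Finset.sum_add_distrib, ← Finset.sum_mul, sum_coordL, zero_mul, add_zero]
  have hc := 𝒯.sum_fluxCoeff a β T
  have hcf : ∑ v, 𝒯.fluxCoeff a β ⟨T, v⟩ * f v.1 = β T / (d + 1) * σ - f.linear (a T) := by
    simp only [fluxCoeff, sub_mul]
    rw [Finset.sum_sub_distrib, ← Finset.mul_sum, hl]
  have : ∑ v, 𝒯.fluxCoeff a β ⟨T, v⟩ * f (barycenter (𝒯.side T v))
      = (d : ℝ)⁻¹ * (β T * σ - (β T / (d + 1) * σ - f.linear (a T))) := by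
    rw [← hcf, ← hc, Finset.sum_mul, ← Finset.sum_sub_distrib, Finset.mul_sum]
    refine Finset.sum_congr rfl fun v _ => ?_
    rw [hs]; ring
  rw [this, hT]
  field_simp
  ring

theorem inner_gradient_eq {η : Rd d → ℝ} (x w : Rd d) :
    inner ℝ w (gradient η x) = fderiv ℝ η x w := by
  rw [gradient, real_inner_comm, InnerProductSpace.toDual_symm_apply]

/-- Because the flux coefficients sum to `β`, the integrand is `∑ c_v div ((x - v) η) - d β η`, and
each divergence integrates to a facet mean. -/
theorem setIntegral_inner_gradient {y : 𝒯.L1 (Rd d)} {a : 𝒯.L0 (Rd d)} {β : 𝒯.L0 ℝ}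
    (hy : ∀ T x, y T x = a T + β T • (x - barycenter T.1)) {η : Rd d → ℝ} (hη : ContDiff ℝ 1 η)
    (T : 𝒯.Element) :
    ∫ x in cell T.1, inner ℝ (y T x) (gradient η x)
      = ∑ v, 𝒯.flux a β ⟨T, v⟩ * facetMean volume (𝒯.basis T) v η
        - d * β T * ∫ x in cell T.1, η x := by
  have hc := hη.continuous
  have hc' := hη.continuous_fderiv (by simp)
  have hi : ∀ g : Rd d → ℝ, Continuous g → IntegrableOn g (cell T.1) := fun g hg =>
    hg.continuousOn.integrableOn_compact (isCompact_cell T.1)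
  have h1 : ∀ x, inner ℝ (y T x) (gradient η x)
      = ∑ v, 𝒯.fluxCoeff a β ⟨T, v⟩ * (fderiv ℝ η x (x - 𝒯.basis T v) + d * η x)
        - d * β T * η x := by
    intro x
    rw [inner_gradient_eq, hy, ← sum_fluxCoeff_smul, map_sum, ← 𝒯.sum_fluxCoeff a β T]
    simp only [map_smul, smul_eq_mul, mul_add, basis_apply, Finset.sum_add_distrib,
      Finset.mul_sum, Finset.sum_mul]
    rw [eq_sub_iff_add_eq]
    congr 1
    exact Finset.sum_congr rfl fun v _ => by ring
  simp only [h1]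
  rw [integral_sub (hi _ (by fun_prop)) (hi _ (by fun_prop)), integral_const_mul,
    integral_finsetSum _ (fun v _ => hi _ (by fun_prop))]
  congr 1
  refine Finset.sum_congr rfl fun v _ => ?_
  rw [integral_const_mul, cell_eq_simplex]
  have := setIntegral_eq_facetMean volume (𝒯.basis T) v η
  rw [finrank_euclideanSpace_fin] at this
  rw [this, flux, vol, cell_eq_simplex]
  ring

theorem sum_setIntegral_inner_gradient {y : 𝒯.L1 (Rd d)} {a : 𝒯.L0 (Rd d)} {β : 𝒯.L0 ℝ}
    (hy : ∀ T x, y T x = a T + β T • (x - barycenter T.1)) {η : Rd d → ℝ} (hη : ContDiff ℝ 1 η) :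
    ∑ T : 𝒯.Element, ∫ x in cell T.1, inner ℝ (y T x) (gradient η x)
      = ∑ p : 𝒯.Facet, 𝒯.flux a β p * facetMean volume (𝒯.basis p.1) p.2 η
        - ∑ T : 𝒯.Element, d * β T * ∫ x in cell T.1, η x := by
  rw [Fintype.sum_sigma, ← Finset.sum_sub_distrib]
  exact Finset.sum_congr rfl fun T _ => 𝒯.setIntegral_inner_gradient hy hη T

/-- The elementwise constant function with values `c T`. -/
noncomputable def toFun0 (c : 𝒯.L0 ℝ) (x : Rd d) : ℝ :=
  ∑ T : 𝒯.Element, (cell T.1).indicator (fun _ => c T) x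

theorem setIntegral_toFun0_mul (hΩ : IsBoundedLipschitzDomain Ω) (c : 𝒯.L0 ℝ) {η : Rd d → ℝ}
    (hη : Continuous η) :
    ∫ x in Ω, 𝒯.toFun0 c x * η x = ∑ T : 𝒯.Element, c T * ∫ x in cell T.1, η x := by
  have hm : ∀ T : 𝒯.Element, MeasurableSet (cell T.1) := fun T => (isCompact_cell T.1).measurableSet
  have h : ∀ x, 𝒯.toFun0 c x * η x
      = ∑ T : 𝒯.Element, (cell T.1).indicator (fun x => c T * η x) x := by
    intro x
    rw [toFun0, Finset.sum_mul]
    refine Finset.sum_congr rfl fun T _ => ?_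
    by_cases hx : x ∈ cell T.1 <;> simp [hx]
  simp only [h]
  rw [integral_finsetSum]
  · refine Finset.sum_congr rfl fun T _ => ?_
    rw [setIntegral_indicator (hm T), 𝒯.setIntegral_inter_cell hΩ, integral_const_mul]
  · intro T _
    refine IntegrableOn.integrable ?_
    refine ((integrable_indicator_iff (hm T)).2 ?_).integrableOn
    exact (continuous_const.mul hη).continuousOn.integrableOn_compact (isCompact_cell T.1)

/-- Facet terms on the boundary vanish because the test function does; on the remaining sides the
facet mean is the same from each adjacent element and the fluxes cancel. -/
theorem hasWeakDiv_toFun0 (hΩ : IsBoundedLipschitzDomain Ω) (hd : d ≠ 0) {y : 𝒯.L1 (Rd d)}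
    {a : 𝒯.L0 (Rd d)} {β : 𝒯.L0 ℝ} (hy : ∀ T x, y T x = a T + β T • (x - barycenter T.1))
    (hjump : ∀ p : 𝒯.Facet, ¬ cell p.side ⊆ frontier Ω → 𝒯.fluxJump a β p = 0) :
    𝒯.HasWeakDiv y (𝒯.toFun0 fun T => d * β T) := by
  classical
  constructor
  · refine integrable_finsetSum _ fun T _ => ?_
    refine IntegrableOn.integrable ?_
    refine ((integrable_indicator_iff (isCompact_cell T.1).measurableSet).2 ?_).integrableOn
    exact integrableOn_const (isCompact_cell T.1).measure_lt_top.ne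
  · intro η hη _ hsupp
    have hη1 : ContDiff ℝ 1 η := hη.of_le (by exact_mod_cast le_top)
    rw [𝒯.setIntegral_toFun0_mul hΩ _ hη.continuous, 𝒯.sum_setIntegral_inner_gradient hy hη1]
    rw [sum_mul_eq_zero_of_fiber (fun p : 𝒯.Facet => p.side) (𝒯.flux a β)
      (fun p => facetMean volume (𝒯.basis p.1) p.2 η), zero_sub]
    · intro p q hpq
      exact 𝒯.facetMean_eq_of_side_eq hd hpq hη1
    · intro p
      by_cases hp : cell p.side ⊆ frontier Ω
      · left
        have := 𝒯.nontrivial_vertices hd p.1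
        refine facetMean_eq_zero _ _ hη1 fun x hx hx0 => ?_
        rw [← cell_eq_simplex] at hx
        have h1 := hp (𝒯.mem_cell_side.2 ⟨hx, hx0⟩)
        rw [hΩ.isOpen.frontier_eq] at h1
        exact image_eq_zero_of_notMem_tsupport fun h => h1.2 (hsupp h)
      · right
        have := hjump p hp
        rw [fluxJump] at this
        convert! this

/-- The weak divergence of an elementwise Raviart-Thomas field is the elementwise one. -/
theorem HasWeakDiv.ae_eq_interior (hΩ : IsBoundedLipschitzDomain Ω) {𝒯 : Triangulation Ω}
    (hd : d ≠ 0) {y : 𝒯.L1 (Rd d)} {g : Rd d → ℝ} (hg : 𝒯.HasWeakDiv y g)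
    {a : 𝒯.L0 (Rd d)} {β : 𝒯.L0 ℝ} (hy : ∀ T x, y T x = a T + β T • (x - barycenter T.1))
    (T : 𝒯.Element) : ∀ᵐ x, x ∈ interior (cell T.1) → g x = d * β T := by
  have hsub := 𝒯.interior_cell_subset hΩ T
  have hgi : IntegrableOn g (interior (cell T.1)) := hg.1.mono_set hsub
  have hfin : volume (interior (cell T.1)) ≠ ⊤ :=
    measure_ne_top_of_subset interior_subset (isCompact_cell T.1).measure_lt_top.ne
  have hfi : IntegrableOn (fun x => g x - d * β T) (interior (cell T.1)) :=
    hgi.sub (integrableOn_const hfin)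
  -- For test functions supported inside `T` all facet terms vanish, and the fundamental lemma of
  -- the calculus of variations applies.
  have key := isOpen_interior.ae_eq_zero_of_integral_contDiff_smul_eq_zero
    (U := interior (cell T.1)) (f := fun x => g x - d * β T) (μ := volume)
    hfi.locallyIntegrableOn ?_
  · filter_upwards [key] with x hx hxT using sub_eq_zero.1 (hx hxT)
  intro η hη hηc hηs
  have hη1 : ContDiff ℝ 1 η := hη.of_le (by exact_mod_cast le_top)
  have hη0 : ∀ x, x ∉ interior (cell T.1) → η x = 0 := fun x hx =>
    image_eq_zero_of_notMem_tsupport fun h => hx (hηs h)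
  have h1 := hg.2 η hη hηc (hηs.trans hsub)
  rw [Finset.sum_eq_single T ?_ (by simp), 𝒯.setIntegral_inner_gradient hy hη1] at h1
  · rw [Finset.sum_eq_zero, zero_sub, neg_inj] at h1
    · have h2 : ∫ x in Ω, g x * η x = ∫ x in interior (cell T.1), g x * η x := by
        rw [setIntegral_eq_of_subset_of_forall_sdiff_eq_zero hΩ.isOpen.measurableSet hsub]
        intro x hx
        rw [hη0 x hx.2, mul_zero]
      rw [← setIntegral_eq_integral_of_forall_compl_eq_zero (s := interior (cell T.1))
        (f := fun x => η x • (g x - d * β T)) (fun x hx => by rw [hη0 x hx, zero_smul])]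
      have hηb : ∃ C, ∀ x, ‖η x‖ ≤ C := hη.continuous.bounded_above_of_compact_support hηc
      obtain ⟨C, hC⟩ := hηb
      have hi : ∀ f : Rd d → ℝ, IntegrableOn f (interior (cell T.1)) →
          IntegrableOn (fun x => f x * η x) (interior (cell T.1)) := fun f hf =>
        hf.mul_bdd hη.continuous.aestronglyMeasurable (Filter.Eventually.of_forall hC)
      have h3 : ∀ x, η x • (g x - d * β T) = g x * η x - (d * β T) * η x := by
        intro x; rw [smul_eq_mul]; ring
      simp only [h3]
      rw [integral_sub (hi g hgi) (hi _ (integrableOn_const hfin)), ← h2, ← h1,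
        integral_const_mul, setIntegral_interior_cell, sub_self]
    · intro v _
      have := 𝒯.nontrivial_vertices hd T
      rw [facetMean_eq_zero _ _ hη1, mul_zero]
      intro x _ hx0
      refine hη0 x fun hx => ?_
      exact ((𝒯.mem_interior_cell T).1 hx v).ne' hx0
  · intro T' _ hne
    refine setIntegral_eq_zero_of_forall_eq_zero fun x hx => ?_
    have hxs : x ∉ tsupport η := fun h => hne (𝒯.eq_of_mem_interior_cell (hηs h) hx).symm
    rw [inner_gradient_eq, fderiv_of_notMem_tsupport ℝ hxs]
    rfl

theorem HasWeakDiv.setIntegral_cell (hΩ : IsBoundedLipschitzDomain Ω) {𝒯 : Triangulation Ω}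
    (hd : d ≠ 0) {y : 𝒯.L1 (Rd d)} {g : Rd d → ℝ} (hg : 𝒯.HasWeakDiv y g)
    {a : 𝒯.L0 (Rd d)} {β : 𝒯.L0 ℝ} (hy : ∀ T x, y T x = a T + β T • (x - barycenter T.1))
    (T : 𝒯.Element) : ∫ x in cell T.1, g x = d * β T * 𝒯.vol T := by
  have h : ∫ x in interior (cell T.1), g x = ∫ x in interior (cell T.1), d * β T :=
    setIntegral_congr_ae isOpen_interior.measurableSet (hg.ae_eq_interior hΩ hd hy T)
  rw [setIntegral_interior_cell, setIntegral_interior_cell] at h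
  rw [h, setIntegral_const, vol, smul_eq_mul, mul_comm]

theorem HasWeakDiv.ae_eq_toFun0 (hΩ : IsBoundedLipschitzDomain Ω) {𝒯 : Triangulation Ω}
    (hd : d ≠ 0) {y : 𝒯.L1 (Rd d)} {g : Rd d → ℝ} (hg : 𝒯.HasWeakDiv y g)
    {a : 𝒯.L0 (Rd d)} {β : 𝒯.L0 ℝ} (hy : ∀ T x, y T x = a T + β T • (x - barycenter T.1)) :
    ∀ᵐ x, x ∈ Ω → g x = 𝒯.toFun0 (fun T => d * β T) x := by
  have h1 : ∀ᵐ x, ∀ T : 𝒯.Element, x ∈ interior (cell T.1) → g x = d * β T :=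
    ae_all_iff.2 fun T => hg.ae_eq_interior hΩ hd hy T
  have h2 : ∀ᵐ x, ∀ T : 𝒯.Element, x ∈ cell T.1 → x ∈ interior (cell T.1) := by
    refine ae_all_iff.2 fun T => ?_
    have := volume_cell_diff_interior (d := d) T.1
    rw [ae_iff]
    convert! this using 2
    ext x; simp
  filter_upwards [h1, h2] with x hx1 hx2 hxΩ
  obtain ⟨T, hT⟩ := 𝒯.exists_mem_cell (subset_closure hxΩ)
  rw [toFun0, Finset.sum_eq_single T _ (by simp), Set.indicator_of_mem hT, hx1 T (hx2 T hT)]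
  intro T' _ hne
  exact Set.indicator_of_notMem
    (fun h => hne (𝒯.eq_of_mem_interior_cell (hx2 T hT) h).symm) _

/-- The fluxes through an inner side cancel if there is a weak divergence. -/
theorem HasWeakDiv.fluxJump_eq_zero (hΩ : IsBoundedLipschitzDomain Ω) {𝒯 : Triangulation Ω}
    (hd : d ≠ 0) {y : 𝒯.L1 (Rd d)} {g : Rd d → ℝ} (hg : 𝒯.HasWeakDiv y g)
    {a : 𝒯.L0 (Rd d)} {β : 𝒯.L0 ℝ} (hy : ∀ T x, y T x = a T + β T • (x - barycenter T.1))
    (p : 𝒯.Facet) (hp : ¬ cell p.side ⊆ frontier Ω) : 𝒯.fluxJump a β p = 0 := by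
  classical
  have hsides : ∀ q : 𝒯.Facet, q.side ∈ 𝒯.sides := fun q => 𝒯.side_mem_sides hd q.1 q.2
  have hcc : barycenter p.side ∈ cell p.side :=
    barycenter_mem_cell (𝒯.side_nonempty hd p.1 p.2)
  have hcΩ : barycenter p.side ∈ Ω := by
    by_contra h
    refine hp (𝒯.cell_subset_frontier hΩ hd (hsides p) ?_)
    rw [hΩ.isOpen.frontier_eq]
    exact ⟨𝒯.cell_subset_closure (hsides p).1 hcc, h⟩
  -- A test function supported near the midpoint, away from all other sides, isolates the flux jump
  -- across this side.
  have hU : ∀ᶠ x in 𝓝 (barycenter p.side),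
      x ∈ Ω ∧ ∀ q : 𝒯.Facet, q.side ≠ p.side → x ∉ cell q.side := by
    refine Filter.Eventually.and (hΩ.isOpen.mem_nhds hcΩ) (Filter.eventually_all.2 fun q => ?_)
    by_cases hq : q.side = p.side
    · simp [hq]
    · have : barycenter p.side ∈ (cell q.side)ᶜ := fun h =>
        hq (𝒯.sides_eq_of_barycenter_mem (hsides p) (hsides q) h).symm
      filter_upwards [(isCompact_cell q.side).isClosed.isOpen_compl.mem_nhds this] with x hx _
        using hx
  obtain ⟨f, hfs, hfc, hf, hfr, hf1⟩ := exists_contDiff_tsupport_subset (n := (⊤ : ℕ∞)) hU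
  -- The factor `2` makes `η` exceed `1` at the midpoint, hence near it by continuity, as
  -- `facetMean_pos` requires.
  set η : Rd d → ℝ := fun x => 2 * f x with hη
  have hηs : tsupport η ⊆ tsupport f := closure_mono fun x hx => by
    simp only [hη, Function.mem_support] at hx ⊢
    exact right_ne_zero_of_mul hx
  have hηsm : ContDiff ℝ ((⊤ : ℕ∞) : WithTop ℕ∞) η := contDiff_const.mul hf
  have hη1 : ContDiff ℝ 1 η := hηsm.of_le (by exact_mod_cast le_top)
  have hpos : 0 < facetMean volume (𝒯.basis p.1) p.2 η := by
    have hc := 𝒯.mem_cell_side.1 hcc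
    refine facetMean_pos volume _ (by simpa using hd) hη1 (fun x => ?_) (c := barycenter p.side)
      (by rw [← cell_eq_simplex]; exact hc.1) hc.2 ?_
    · have := (hfr (Set.mem_range_self x)).1
      simp only [hη]; linarith
    · have : (1 : ℝ) < η (barycenter p.side) := by simp [hη, hf1]
      exact (hη1.continuous.tendsto _).eventually (lt_mem_nhds this) |>.mono fun x hx => hx.le
  have h0 : ∀ q : 𝒯.Facet, q.side ≠ p.side → facetMean volume (𝒯.basis q.1) q.2 η = 0 := by
    intro q hq
    have := 𝒯.nontrivial_vertices hd q.1
    refine facetMean_eq_zero _ _ hη1 fun x hx hx0 => ?_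
    rw [← cell_eq_simplex] at hx
    exact image_eq_zero_of_notMem_tsupport fun h =>
      (hfs (hηs h)).2 q hq (𝒯.mem_cell_side.2 ⟨hx, hx0⟩)
  have hid := hg.2 η hηsm (hfc.mono fun x hx => by
    simp only [hη, Function.mem_support] at hx ⊢
    exact right_ne_zero_of_mul hx) (hηs.trans (hfs.trans fun x hx => hx.1))
  have hgη : ∫ x in Ω, g x * η x = ∫ x in Ω, 𝒯.toFun0 (fun T => d * β T) x * η x := by
    refine setIntegral_congr_ae hΩ.isOpen.measurableSet ?_
    filter_upwards [hg.ae_eq_toFun0 hΩ hd hy] with x hx hxΩ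
    rw [hx hxΩ]
  rw [hgη, 𝒯.setIntegral_toFun0_mul hΩ _ hη1.continuous,
    𝒯.sum_setIntegral_inner_gradient hy hη1, sub_eq_neg_self] at hid
  have hsum : ∑ q : 𝒯.Facet, 𝒯.flux a β q * facetMean volume (𝒯.basis q.1) q.2 η
      = 𝒯.fluxJump a β p * facetMean volume (𝒯.basis p.1) p.2 η := by
    rw [fluxJump, Finset.sum_mul, Finset.sum_filter]
    refine Finset.sum_congr rfl fun q _ => ?_
    split_ifs with hq
    · rw [𝒯.facetMean_eq_of_side_eq hd hq hη1]
    · rw [h0 q hq, mul_zero]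
  rw [hsum] at hid
  exact (mul_eq_zero.1 hid).resolve_right hpos.ne'

end Triangulation
end DiscreteDuality

/-! ### Fenchel-Young inequality and weak duality -/

namespace DiscreteDuality

section ERealSums

variable {ι : Type*}

theorem EReal_sum_ne_bot {s : Finset ι} {f : ι → EReal} (h : ∀ i ∈ s, f i ≠ ⊥) :
    ∑ i ∈ s, f i ≠ ⊥ := by
  classical
  induction s using Finset.induction_on with
  | empty => simp
  | insert i s hi ih =>
    rw [Finset.sum_insert hi, EReal.add_ne_bot_iff]
    exact ⟨h i (Finset.mem_insert_self i s), ih fun j hj => h j (Finset.mem_insert_of_mem hj)⟩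

/-- Since `⊤ + ⊥ = ⊥` in `EReal`, a summand `⊤` dominates only when `⊥` is excluded. -/
theorem EReal_sum_eq_top {s : Finset ι} {f : ι → EReal} (h : ∀ i ∈ s, f i ≠ ⊥) {i : ι}
    (hi : i ∈ s) (hf : f i = ⊤) : ∑ i ∈ s, f i = ⊤ := by
  classical
  rw [← Finset.add_sum_erase _ _ hi, hf]
  exact EReal.top_add_of_ne_bot (EReal_sum_ne_bot fun j hj => h j (Finset.mem_of_mem_erase hj))

theorem EReal_coe_sum (s : Finset ι) (f : ι → ℝ) :
    ((∑ i ∈ s, f i : ℝ) : EReal) = ∑ i ∈ s, (f i : EReal) := by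
  classical
  induction s using Finset.induction_on with
  | empty => simp
  | insert i s hi ih => rw [Finset.sum_insert hi, Finset.sum_insert hi, EReal.coe_add, ih]

theorem coe_mul_ne_bot {c : ℝ} (hc : 0 < c) {x : EReal} (hx : x ≠ ⊥) : (c : EReal) * x ≠ ⊥ := by
  induction x with
  | bot => exact absurd rfl hx
  | top => rw [EReal.coe_mul_top_of_pos hc]; simp
  | coe x => rw [← EReal.coe_mul]; exact EReal.coe_ne_bot _

/-- The weak duality inequality for weighted sums. -/
theorem neg_sum_le_sum [Fintype ι] {m : ι → ℝ} (hm : ∀ i, 0 < m i) {P C : ι → EReal}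
    {r c : ι → ℝ} (hP : ∀ i, P i ≠ ⊥) (hC : ∀ i, C i ≠ ⊥) (hPC : ∀ i, (c i : EReal) ≤ P i + C i)
    (h0 : ∑ i, (m i * c i + r i) = 0) :
    - ∑ i, ((m i : EReal) * C i + (r i : EReal)) ≤ ∑ i, (m i : EReal) * P i := by
  have hPb : ∀ i ∈ Finset.univ, (m i : EReal) * P i ≠ ⊥ := fun i _ => coe_mul_ne_bot (hm i) (hP i)
  have hCb : ∀ i ∈ Finset.univ, (m i : EReal) * C i + (r i : EReal) ≠ ⊥ := fun i _ =>
    EReal.add_ne_bot_iff.2 ⟨coe_mul_ne_bot (hm i) (hC i), EReal.coe_ne_bot _⟩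
  by_cases hPt : ∃ i, P i = ⊤
  · obtain ⟨i, hi⟩ := hPt
    rw [EReal_sum_eq_top hPb (Finset.mem_univ i) (by rw [hi, EReal.coe_mul_top_of_pos (hm i)])]
    exact le_top
  -- An infinite conjugate makes the left-hand side `⊥`; with both families finite the inequality is
  -- one between real sums.
  by_cases hCt : ∃ i, C i = ⊤
  · obtain ⟨i, hi⟩ := hCt
    rw [EReal_sum_eq_top hCb (Finset.mem_univ i)
      (by rw [hi, EReal.coe_mul_top_of_pos (hm i), EReal.top_add_of_ne_bot (EReal.coe_ne_bot _)])]
    simp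
  push Not at hPt hCt
  lift P to ι → ℝ using fun i => ⟨hPt i, hP i⟩
  lift C to ι → ℝ using fun i => ⟨hCt i, hC i⟩
  simp only [← EReal.coe_mul, ← EReal.coe_add, ← EReal_coe_sum, ← EReal.coe_neg,
    EReal.coe_le_coe_iff] at hPC ⊢
  have : ∑ i, (m i * c i + r i) ≤ ∑ i, (m i * P i + (m i * C i + r i)) :=
    Finset.sum_le_sum fun i _ => by nlinarith [hPC i, hm i]
  rw [Finset.sum_add_distrib (f := fun i => m i * P i)] at this
  linarith

end ERealSums

section Conjugate

variable {d : ℕ} {φ : Rd d → EReal}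

theorem IsProperConvexLsc.conj_ne_bot (hφ : IsProperConvexLsc φ) (t : Rd d) : conj φ t ≠ ⊥ := by
  obtain ⟨s, hs⟩ := hφ.exists_ne_top
  have h : ((inner ℝ t s : ℝ) : EReal) - φ s ≤ conj φ t :=
    le_iSup (fun s => ((inner ℝ t s : ℝ) : EReal) - φ s) s
  intro hb
  rw [hb, le_bot_iff] at h
  lift φ s to ℝ using ⟨hs, hφ.ne_bot s⟩ with x
  rw [← EReal.coe_sub] at h
  exact EReal.coe_ne_bot _ h

/-- The Fenchel-Young inequality. -/
theorem IsProperConvexLsc.inner_le (hφ : IsProperConvexLsc φ) (t s : Rd d) :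
    ((inner ℝ t s : ℝ) : EReal) ≤ φ s + conj φ t := by
  have h : ((inner ℝ t s : ℝ) : EReal) - φ s ≤ conj φ t :=
    le_iSup (fun s => ((inner ℝ t s : ℝ) : EReal) - φ s) s
  rwa [EReal.sub_le_iff_le_add (Or.inl (hφ.ne_bot s)) (Or.inr (hφ.conj_ne_bot t)), add_comm] at h

end Conjugate

namespace Triangulation

variable {d : ℕ} {Ω : Set (Rd d)} (𝒯 : Triangulation Ω)

/-- All barycentric coordinates have mean `1 / (d + 1)`, their common value at the barycenter. -/
theorem proj0_eq (hd : d ≠ 0) {F : Type} [NormedAddCommGroup F] [NormedSpace ℝ F]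
    [CompleteSpace F] (w : 𝒯.L1 F) (T : 𝒯.Element) : 𝒯.proj0 w T = w T (barycenter T.1) := by
  have := 𝒯.nontrivial_vertices hd T
  have hne : T.1.Nonempty := by rw [← Finset.card_pos, T.2.2]; omega
  have hcell := 𝒯.cell_eq_simplex T
  have hi : ∀ v ∈ Finset.univ, Integrable
      (fun x => (𝒯.basis T).coord v x • w T v.1) (volume.restrict (cell T.1)) := by
    intro v _
    exact ((continuous_barycentric_coord (𝒯.basis T) v).smul
      continuous_const).continuousOn.integrableOn_compact (isCompact_cell T.1)
  have hv : volume.real (cell T.1) ≠ 0 := (𝒯.vol_pos T).ne'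
  have hw : ∀ x, w T x = ∑ v, (𝒯.basis T).coord v x • w T v.1 :=
    affineMap_eq_sum_coord (𝒯.basis T) (w T)
  have hw' : (fun x => w T x) = fun x => ∑ v, (𝒯.basis T).coord v x • w T v.1 := funext hw
  rw [proj0, setAverage_eq, hw', hw (barycenter T.1), integral_finsetSum _ hi]
  simp_rw [integral_smul_const]
  rw [hcell]
  simp_rw [setIntegral_coord, 𝒯.coord_barycenter_element, finrank_euclideanSpace_fin,
    ← hcell]
  rw [← Finset.smul_sum, ← Finset.smul_sum, smul_smul, div_eq_mul_inv, inv_mul_cancel_left₀ hv]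

theorem inner_gradH (u : 𝒯.L1 ℝ) (T : 𝒯.Element) (w : Rd d) :
    inner ℝ w (𝒯.gradH u T) = (u T).linear w := by
  have h : ∀ x, u T x = LinearMap.toContinuousLinearMap (u T).linear x + u T 0 := fun x =>
    congrFun (u T).decomp x
  have hf : HasFDerivAt (fun x => u T x) (LinearMap.toContinuousLinearMap (u T).linear)
      (barycenter T.1) := by
    rw [show (fun x => u T x) = _ from funext h]
    exact (ContinuousLinearMap.hasFDerivAt _).add_const _
  rw [gradH, inner_gradient_eq, hf.fderiv]
  rfl

/-- The discrete integration by parts formula. -/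
theorem sum_inner_gradH (hd : d ≠ 0) (a : 𝒯.L0 (Rd d)) (β : 𝒯.L0 ℝ) (u : 𝒯.L1 ℝ) :
    ∑ T : 𝒯.Element, (𝒯.vol T * inner ℝ (a T) (𝒯.gradH u T)
        + 𝒯.proj0 u T * (d * β T * 𝒯.vol T))
      = d * ∑ p : 𝒯.Facet, 𝒯.flux a β p * u p.1 (barycenter p.side) := by
  rw [Fintype.sum_sigma, Finset.mul_sum]
  refine Finset.sum_congr rfl fun T _ => ?_
  have h := 𝒯.sum_fluxCoeff_mul hd a β T (u T)
  have h' : ∑ v, 𝒯.flux a β ⟨T, v⟩ * u T (barycenter (𝒯.side T v))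
      = 𝒯.vol T * ∑ v, 𝒯.fluxCoeff a β ⟨T, v⟩ * u T (barycenter (𝒯.side T v)) := by
    simp only [flux, mul_assoc]
    rw [← Finset.mul_sum]
  change _ = d * ∑ v, 𝒯.flux a β ⟨T, v⟩ * u T (barycenter (𝒯.side T v))
  rw [h', inner_gradH, 𝒯.proj0_eq hd]
  linear_combination (-𝒯.vol T) * h

/-- The normal component of a Raviart-Thomas field on a side. -/
theorem inner_outerNormal {y : 𝒯.L1 (Rd d)} {a : 𝒯.L0 (Rd d)} {β : 𝒯.L0 ℝ}
    (hy : ∀ T x, y T x = a T + β T • (x - barycenter T.1)) (hd : d ≠ 0) (p : 𝒯.Facet) {n : Rd d}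
    (hn : IsOuterUnitNormal p.1.1 p.side n) {x : Rd d} (hx : x ∈ cell p.side) :
    inner ℝ (y p.1 x) n = 𝒯.fluxCoeff a β p * inner ℝ (x - p.2.1) n ∧
      0 < inner ℝ (x - p.2.1) n := by
  obtain ⟨T, v⟩ := p
  have h0 : ∀ w ∈ 𝒯.side T v, inner ℝ (x - w) n = (0 : ℝ) := by
    intro w hw
    have hconv : Convex ℝ {x : Rd d | inner ℝ n x = inner ℝ n w} :=
      convex_hyperplane (innerₗ (Rd d) n).isLinear _
    have := convexHull_min (fun z hz => ?_) hconv hx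
    · rw [real_inner_comm, inner_sub_right, sub_eq_zero]; exact this
    · have h := hn.2.1 z hz w hw
      rwa [inner_sub_right, sub_eq_zero] at h
  constructor
  -- For vertices `w` of the side, `x - w` is tangential, so only the term of the opposite vertex
  -- survives.
  · rw [hy, ← sum_fluxCoeff_smul, sum_inner, Finset.sum_eq_single v _ (by simp), inner_smul_left]
    · rfl
    · intro w _ hw
      rw [inner_smul_left, h0 w (𝒯.mem_side.2 ⟨fun h => hw (Subtype.ext h), w.2⟩), mul_zero]
  · obtain ⟨w, hw⟩ := 𝒯.side_nonempty hd T v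
    have h1 := hn.2.2 v.1 v.2 (by simp [mem_side]) w hw
    have h2 : x - v.1 = (x - w) - (v.1 - w) := by abel
    change 0 < inner ℝ (x - v.1) n
    rw [h2, inner_sub_left, h0 w hw, real_inner_comm]
    linarith

theorem exists_isOuterUnitNormal (hd : d ≠ 0) (p : 𝒯.Facet) :
    ∃ n, IsOuterUnitNormal p.1.1 p.side n := by
  obtain ⟨T, v⟩ := p
  set g : Rd d := (InnerProductSpace.toDual ℝ (Rd d)).symm (coordL (𝒯.basis T) v) with hg
  have hgi : ∀ x y : Rd d, inner ℝ g (x - y) = (𝒯.basis T).coord v x - (𝒯.basis T).coord v y := by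
    intro x y
    rw [hg, InnerProductSpace.toDual_symm_apply, coordL_sub]
  have hs : ∀ w ∈ 𝒯.side T v, (𝒯.basis T).coord v w = 0 := fun w hw => by
    rw [𝒯.coord_coe (𝒯.mem_side.1 hw).2, if_neg (𝒯.mem_side.1 hw).1]
  have hv : (𝒯.basis T).coord v v.1 = 1 := by rw [𝒯.coord_coe v.2, if_pos rfl]
  have hg0 : 0 < ‖g‖ := by
    obtain ⟨w, hw⟩ := 𝒯.side_nonempty hd T v
    rw [norm_pos_iff]
    intro h
    have := hgi v.1 w
    rw [h, inner_zero_left, hv, hs w hw] at this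
    norm_num at this
  refine ⟨(-‖g‖⁻¹) • g, ?_, ?_, ?_⟩
  · rw [norm_smul, norm_neg, norm_inv, norm_norm, inv_mul_cancel₀ hg0.ne']
  · intro w hw w' hw'
    rw [inner_smul_left, hgi, hs w hw, hs w' hw', sub_self, mul_zero]
  · intro z hz hzs w hw
    have : z = v.1 := by
      by_contra h
      exact hzs (𝒯.mem_side.2 ⟨h, hz⟩)
    rw [inner_smul_left, hgi, this, hv, hs w hw]
    simpa using hg0

theorem weakDiv_spec {y : 𝒯.L1 (Rd d)} (h : ∃ g, 𝒯.HasWeakDiv y g) :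
    𝒯.HasWeakDiv y (𝒯.weakDiv y) := by
  rw [weakDiv, dif_pos h]
  exact h.choose_spec

/-- The fluxes of a field in `RTN` through a side that is not in `ΓD` cancel. -/
theorem fluxJump_eq_zero_of_mem_RTN (hΩ : IsBoundedLipschitzDomain Ω) (hd : d ≠ 0)
    {ΓD : Set (Rd d)} {y : 𝒯.L1 (Rd d)} (hyN : y ∈ 𝒯.RTN (frontier Ω \ ΓD))
    {a : 𝒯.L0 (Rd d)} {β : 𝒯.L0 ℝ} (hy : ∀ T x, y T x = a T + β T • (x - barycenter T.1))
    (p : 𝒯.Facet) (hp : ¬ openCell p.side ⊆ ΓD) : 𝒯.fluxJump a β p = 0 := by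
  classical
  by_cases hfr : cell p.side ⊆ frontier Ω
  -- One point of the open side outside `ΓD` suffices: the normal component there is a positive
  -- multiple of the flux coefficient, a single number for the whole side.
  · obtain ⟨x, hx, hxD⟩ := Set.not_subset.1 hp
    have hxc : x ∈ cell p.side := intrinsicInterior_subset hx
    rw [fluxJump]
    refine Finset.sum_eq_zero fun q hq => ?_
    have hqp : q.side = p.side := (Finset.mem_filter.1 hq).2
    rw [← hqp] at hx hxc hfr
    obtain ⟨n, hn⟩ := 𝒯.exists_isOuterUnitNormal hd q
    have h1 := hyN.2 q.side (𝒯.side_mem_sides hd q.1 q.2) hfr q.1 (𝒯.side_subset q.1 q.2) n hn x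
      ⟨hx, hfr hxc, hxD⟩
    obtain ⟨h2, h3⟩ := 𝒯.inner_outerNormal hy hd q hn hxc
    rw [h1, eq_comm, mul_eq_zero] at h2
    rw [flux, h2.resolve_right h3.ne', mul_zero]
  · exact (𝒯.weakDiv_spec hyN.1.1).fluxJump_eq_zero hΩ hd hy p hfr

theorem sum_flux_mul_eq_zero (hd : d ≠ 0) {ΓD : Set (Rd d)} {a : 𝒯.L0 (Rd d)} {β : 𝒯.L0 ℝ}
    (hjump : ∀ p : 𝒯.Facet, ¬ openCell p.side ⊆ ΓD → 𝒯.fluxJump a β p = 0)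
    {u : 𝒯.L1 ℝ} (hu : u ∈ 𝒯.CRD ΓD) :
    ∑ p : 𝒯.Facet, 𝒯.flux a β p * u p.1 (barycenter p.side) = 0 := by
  classical
  refine sum_mul_eq_zero_of_fiber (fun p : 𝒯.Facet => p.side) (𝒯.flux a β)
    (fun p => u p.1 (barycenter p.side)) (fun p q hpq => ?_) (fun p => ?_)
  · have hpq : p.side = q.side := hpq
    have := hu.1 p.side (𝒯.side_mem_sides hd p.1 p.2) p.1 q.1 (𝒯.side_subset p.1 p.2)
      (hpq ▸ 𝒯.side_subset q.1 q.2)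
    change u p.1 (barycenter p.side) = u q.1 (barycenter q.side)
    rw [this, hpq]
  · by_cases hp : openCell p.side ⊆ ΓD
    · left
      exact hu.2 p.side (𝒯.side_mem_sides hd p.1 p.2) hp p.1 (𝒯.side_subset p.1 p.2)
    · right
      have := hjump p hp
      rw [fluxJump] at this
      convert! this

theorem exists_coeff_of_mem_RT {y : 𝒯.L1 (Rd d)} (hy : y ∈ 𝒯.RT) :
    ∃ (a : 𝒯.L0 (Rd d)) (β : 𝒯.L0 ℝ), ∀ T x, y T x = a T + β T • (x - barycenter T.1) := by
  choose a β h using hy.2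
  exact ⟨a, β, h⟩

theorem proj0_of_coeff (hd : d ≠ 0) {y : 𝒯.L1 (Rd d)} {a : 𝒯.L0 (Rd d)} {β : 𝒯.L0 ℝ}
    (hy : ∀ T x, y T x = a T + β T • (x - barycenter T.1)) (T : 𝒯.Element) :
    𝒯.proj0 y T = a T := by
  rw [𝒯.proj0_eq hd, hy, sub_self, smul_zero, add_zero]

/-- Fenchel-Young on each element leaves `∑ |T| (a_T · ∇u)` plus the divergence term, and this is
zero by discrete integration by parts. -/
theorem dual_le_primal (hΩ : IsBoundedLipschitzDomain Ω) (hd : d ≠ 0) {ΓD : Set (Rd d)}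
    {φ : Rd d → EReal} (hφ : IsProperConvexLsc φ) {u : 𝒯.L1 ℝ} (hu : u ∈ 𝒯.CRD ΓD)
    {z : 𝒯.L1 (Rd d)} (hz : z ∈ 𝒯.RTN (frontier Ω \ ΓD)) :
    dual 𝒯 φ (𝒯.proj0 u) z ≤ primal 𝒯 φ u := by
  obtain ⟨a, β, hy⟩ := 𝒯.exists_coeff_of_mem_RT hz.1
  have hdiv := (𝒯.weakDiv_spec hz.1.1).setIntegral_cell hΩ hd hy
  rw [dual, primal]
  refine neg_sum_le_sum (c := fun T => inner ℝ (𝒯.proj0 z T) (𝒯.gradH u T)) 𝒯.vol_pos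
    (fun T => hφ.ne_bot _) (fun T => hφ.conj_ne_bot _) (fun T => hφ.inner_le _ _) ?_
  simp only [hdiv, 𝒯.proj0_of_coeff hd hy]
  rw [𝒯.sum_inner_gradH hd, 𝒯.sum_flux_mul_eq_zero hd
    (𝒯.fluxJump_eq_zero_of_mem_RTN hΩ hd hz hy) hu, mul_zero]

end Triangulation
end DiscreteDuality

/-! ### Strong duality by separation -/

namespace DiscreteDuality

/-- A supporting functional for the minimisation of a continuous convex function over an affine
subspace. -/
theorem exists_dual_of_le_on_affineSubspace {X : Type*} [NormedAddCommGroup X] [NormedSpace ℝ X]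
    {J : X → ℝ} (hJ : ConvexOn ℝ Set.univ J) (hJc : Continuous J) (V : Submodule ℝ X) (p₀ : X)
    {m : ℝ} (hm : ∀ v ∈ V, m ≤ J (p₀ + v)) :
    ∃ l : X →L[ℝ] ℝ, (∀ v ∈ V, l v = 0) ∧ ∀ p, l p - J p ≤ l p₀ - m := by
  set s : Set (X × ℝ) := {q | J q.1 < q.2} with hs
  set t : Set (X × ℝ) := {q | q.1 - p₀ ∈ V ∧ q.2 = m} with ht
  have hs1 : Convex ℝ s := by simpa using hJ.convex_strict_epigraph
  have hs2 : IsOpen s := isOpen_lt (hJc.comp continuous_fst) continuous_snd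
  have ht1 : Convex ℝ t := by
    rintro ⟨x, r⟩ ⟨hx, hr⟩ ⟨y, r'⟩ ⟨hy, hr'⟩ a b _ _ hab
    simp only at hx hy hr hr'
    refine ⟨?_, ?_⟩
    · have : a • x + b • y - p₀ = a • (x - p₀) + b • (y - p₀) := by
        rw [smul_sub, smul_sub, sub_add_sub_comm, ← add_smul, hab, one_smul]
      change a • x + b • y - p₀ ∈ V
      rw [this]
      exact V.add_mem (V.smul_mem a hx) (V.smul_mem b hy)
    · change a * r + b * r' = m
      rw [hr, hr', ← add_mul, hab, one_mul]
  have hdisj : Disjoint s t := by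
    rw [Set.disjoint_left]
    rintro ⟨x, r⟩ hx ⟨hxV, hr⟩
    have := hm _ hxV
    rw [add_sub_cancel] at this
    simp only [hs, Set.mem_ofPred_eq] at hx
    simp only at hr
    linarith
  obtain ⟨F, k, hF1, hF2⟩ := geometric_hahn_banach_open hs1 hs2 ht1 hdisj
  set l₁ : X →L[ℝ] ℝ := F.comp (ContinuousLinearMap.inl ℝ X ℝ) with hl₁
  set c : ℝ := F (0, 1) with hc
  have hF : ∀ p r, F (p, r) = l₁ p + r * c := by
    intro p r
    have : (p, r) = (p, (0 : ℝ)) + r • ((0 : X), (1 : ℝ)) := by simp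
    rw [this, map_add, map_smul, smul_eq_mul]
    rfl
  have h1 : ∀ p r, J p < r → l₁ p + r * c < k := fun p r h => by
    rw [← hF]; exact hF1 (p, r) h
  have h2 : ∀ v ∈ V, k ≤ l₁ p₀ + l₁ v + m * c := fun v hv => by
    rw [← map_add, ← hF]
    exact hF2 (p₀ + v, m) ⟨by simpa using hv, rfl⟩
  have h20 := h2 0 V.zero_mem
  rw [map_zero, add_zero] at h20
  have hm0 := hm 0 V.zero_mem
  rw [add_zero] at hm0
  -- The point `p₀` at height `J p₀ + 1` is in the epigraph, strictly above height `m`, so the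
  -- separating hyperplane is not vertical.
  have hcneg : c < 0 := by
    have := h1 p₀ (J p₀ + 1) (by linarith)
    by_contra! hc0
    nlinarith
  have hc0 : c ≠ 0 := hcneg.ne
  refine ⟨(-c⁻¹) • l₁, fun v hv => ?_, fun p => ?_⟩
  · by_contra hne
    have hne : l₁ v ≠ 0 := fun h => hne (by simp [h])
    -- A nonzero value on `V` could be scaled at will; this multiple makes the lower bound read `k ≤
    -- k - 1`.
    have h := h2 (((k - l₁ p₀ - m * c - 1) / l₁ v) • v) (V.smul_mem _ hv)
    rw [map_smul, smul_eq_mul, div_mul_cancel₀ _ hne] at h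
    linarith
  · have h3 : l₁ p + J p * c ≤ l₁ p₀ + m * c := by
      by_contra! hlt
      -- Raising the height by `δ / (-c)` absorbs the excess exactly and stays in the open epigraph,
      -- which contradicts the strict separation.
      set δ := l₁ p + J p * c - (l₁ p₀ + m * c) with hδ
      have hδ0 : 0 < δ := by linarith
      have h := h1 p (J p + δ / (-c)) (by
        have : 0 < δ / (-c) := div_pos hδ0 (by linarith)
        linarith)
      have : (J p + δ / (-c)) * c = J p * c - δ := by field_simp; ring
      rw [this] at h
      linarith
    change (-c⁻¹) * l₁ p - J p ≤ (-c⁻¹) * l₁ p₀ - m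
    have h4 : (-c⁻¹) * l₁ p - J p - ((-c⁻¹) * l₁ p₀ - m)
        = (-c⁻¹) * ((l₁ p + J p * c) - (l₁ p₀ + m * c)) := by
      field_simp; ring
    have h5 : 0 < -c⁻¹ := by simpa using hcneg
    nlinarith

/-- A bound for a separable sum bounds the sum of the suprema. -/
theorem exists_sum_sup_le {ι S : Type*} [Fintype ι] [Nonempty S] {m : ι → ℝ} (hm : ∀ i, 0 < m i)
    {g : ι → S → ℝ} {M : ℝ} (h : ∀ p : ι → S, ∑ i, m i * g i (p i) ≤ M) :
    ∃ c : ι → ℝ, (∀ i s, g i s ≤ c i) ∧ ∑ i, m i * c i ≤ M := by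
  classical
  obtain ⟨s₀⟩ := ‹Nonempty S›
  have hbdd : ∀ i, BddAbove (Set.range (g i)) := by
    intro i
    refine ⟨(M - ∑ j ∈ Finset.univ.erase i, m j * g j s₀) / m i, ?_⟩
    rintro _ ⟨s, rfl⟩
    -- Varying one component while the others stay at `s₀` bounds each summand.
    have := h (Function.update (fun _ => s₀) i s)
    rw [← Finset.add_sum_erase _ _ (Finset.mem_univ i), Function.update_self,
      Finset.sum_congr rfl (g := fun j => m j * g j s₀) (fun j hj => by
        rw [Function.update_of_ne (Finset.ne_of_mem_erase hj)])] at this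
    rw [le_div_iff₀ (hm i)]
    linarith
  refine ⟨fun i => ⨆ s, g i s, fun i s => le_ciSup (hbdd i) s, ?_⟩
  have hS : 0 ≤ ∑ i, m i := Finset.sum_nonneg fun i _ => (hm i).le
  refine le_of_forall_pos_le_add fun ε hε => ?_
  -- The `+ 1` keeps the denominator positive even for an empty index set; the weighted total error
  -- is still at most `ε`.
  have hε' : 0 < ε / (∑ i, m i + 1) := by positivity
  have hex : ∀ i, ∃ s, (⨆ s, g i s) - ε / (∑ i, m i + 1) < g i s := fun i =>
    have : Nonempty S := ⟨s₀⟩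
    exists_lt_of_lt_ciSup (by linarith)
  choose p hp using hex
  have h1 : ∑ i, m i * ((⨆ s, g i s) - ε / (∑ i, m i + 1)) ≤ M :=
    (Finset.sum_le_sum fun i _ => mul_le_mul_of_nonneg_left (hp i).le (hm i).le).trans (h p)
  simp only [mul_sub] at h1
  rw [Finset.sum_sub_distrib, ← Finset.sum_mul] at h1
  have h2 : (∑ i, m i) * (ε / (∑ i, m i + 1)) ≤ ε := by
    rw [mul_div_assoc', div_le_iff₀ (by positivity)]
    nlinarith
  linarith

namespace Triangulation

variable {d : ℕ} {Ω : Set (Rd d)} (𝒯 : Triangulation Ω)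

theorem side_injective {T : 𝒯.Element} {v w : T.1} (h : 𝒯.side T v = 𝒯.side T w) : v = w := by
  by_contra hne
  have : v.1 ∈ 𝒯.side T w := 𝒯.mem_side.2 ⟨fun h' => hne (Subtype.ext h'), v.2⟩
  rw [← h] at this
  exact (𝒯.mem_side.1 this).1 rfl

open Classical in
/-- The Crouzeix-Raviart basis function of a side. -/
noncomputable def crBasis (S : Finset (Rd d)) : 𝒯.L1 ℝ := fun T =>
  if h : ∃ v : T.1, 𝒯.side T v = S then
    AffineMap.const ℝ (Rd d) (1 : ℝ) - (d : ℝ) • (𝒯.basis T).coord h.choose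
  else 0

open Classical in
-- The function `1 - d λ_v` is `1` where `λ_v = 0` and `0` where `λ_v = 1 / d`, the value at the
-- midpoints of the other sides.
theorem crBasis_barycenter (hd : d ≠ 0) (S : Finset (Rd d)) (q : 𝒯.Facet) :
    𝒯.crBasis S q.1 (barycenter q.side) = if q.side = S then 1 else 0 := by
  have hd' : (d : ℝ) ≠ 0 := by exact_mod_cast hd
  obtain ⟨T, w⟩ := q
  change 𝒯.crBasis S T (barycenter (𝒯.side T w)) = if 𝒯.side T w = S then 1 else 0
  rw [crBasis]
  split_ifs with h1 h2 h2
  · have : h1.choose = w := 𝒯.side_injective (h1.choose_spec.trans h2.symm)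
    simp [this, 𝒯.coord_barycenter_side hd]
  · have : h1.choose ≠ w := fun h => h2 (h ▸ h1.choose_spec)
    simp [this, 𝒯.coord_barycenter_side hd, hd']
  · exact absurd ⟨w, h2⟩ h1
  · rfl

theorem crBasis_mem_CRD (hd : d ≠ 0) {ΓD : Set (Rd d)} {S : Finset (Rd d)}
    (hS : ¬ openCell S ⊆ ΓD) : 𝒯.crBasis S ∈ 𝒯.CRD ΓD := by
  classical
  have hval : ∀ S' ∈ 𝒯.sides, ∀ T : 𝒯.Element, S' ⊆ T.1 →
      𝒯.crBasis S T (barycenter S') = if S' = S then 1 else 0 := by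
    intro S' hS' T hT
    obtain ⟨v, rfl⟩ := 𝒯.exists_eq_side hS' hT
    exact 𝒯.crBasis_barycenter hd S ⟨T, v⟩
  refine ⟨fun S' hS' T T' hT hT' => ?_, fun S' hS' hD T hT => ?_⟩
  · rw [hval S' hS' T hT, hval S' hS' T' hT']
  · rw [hval S' hS' T hT, if_neg]
    rintro rfl
    exact hS hD

/-- The space `CRD` as a subspace. -/
def CRDSubmodule (ΓD : Set (Rd d)) : Submodule ℝ (𝒯.L1 ℝ) where
  carrier := 𝒯.CRD ΓD
  add_mem' := by
    rintro u v ⟨hu1, hu2⟩ ⟨hv1, hv2⟩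
    refine ⟨fun S hS T T' hT hT' => ?_, fun S hS hD T hT => ?_⟩
    · change u T _ + v T _ = u T' _ + v T' _
      rw [hu1 S hS T T' hT hT', hv1 S hS T T' hT hT']
    · change u T _ + v T _ = 0
      rw [hu2 S hS hD T hT, hv2 S hS hD T hT, add_zero]
  zero_mem' := ⟨fun _ _ _ _ _ _ => rfl, fun _ _ _ _ _ => rfl⟩
  smul_mem' := by
    rintro c u ⟨hu1, hu2⟩
    refine ⟨fun S hS T T' hT hT' => ?_, fun S hS hD T hT => ?_⟩
    · change c * u T _ = c * u T' _
      rw [hu1 S hS T T' hT hT']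
    · change c * u T _ = 0
      rw [hu2 S hS hD T hT, mul_zero]

/-- The elementwise gradient as a linear map. -/
noncomputable def gradHₗ : 𝒯.L1 ℝ →ₗ[ℝ] 𝒯.L0 (Rd d) where
  toFun := 𝒯.gradH
  map_add' u v := by
    ext1 T
    refine ext_inner_left ℝ fun w => ?_
    rw [Pi.add_apply, inner_add_right, inner_gradH, inner_gradH, inner_gradH]; rfl
  map_smul' c u := by
    ext1 T
    refine ext_inner_left ℝ fun w => ?_
    rw [Pi.smul_apply, RingHom.id_apply, inner_smul_right, inner_gradH, inner_gradH]; rfl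

/-- The value in the midpoint of an element as a linear form. -/
noncomputable def evalBarycenter (T : 𝒯.Element) : 𝒯.L1 ℝ →ₗ[ℝ] ℝ where
  toFun u := u T (barycenter T.1)
  map_add' _ _ := rfl
  map_smul' _ _ := rfl

/-- A linear form on elementwise constant fields is given by weighted inner products. -/
theorem exists_eq_sum_inner (l : 𝒯.L0 (Rd d) →L[ℝ] ℝ) :
    ∃ a : 𝒯.L0 (Rd d), ∀ p, l p = ∑ T, 𝒯.vol T * inner ℝ (a T) (p T) := by
  classical
  refine ⟨fun T => (𝒯.vol T)⁻¹ • (InnerProductSpace.toDual ℝ (Rd d)).symm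
    (l.comp (ContinuousLinearMap.single ℝ (fun _ => Rd d) T)), fun p => ?_⟩
  have hp : p = ∑ T, Pi.single T (p T) := (Finset.univ_sum_single p).symm
  conv_lhs => rw [hp, map_sum]
  refine Finset.sum_congr rfl fun T _ => ?_
  rw [inner_smul_left, InnerProductSpace.toDual_symm_apply, RCLike.conj_to_real,
    mul_inv_cancel_left₀ (𝒯.vol_pos T).ne']
  rfl

/-- The elementwise affine field with the given coefficients. -/
noncomputable def rtField (a : 𝒯.L0 (Rd d)) (β : 𝒯.L0 ℝ) : 𝒯.L1 (Rd d) := fun T =>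
  AffineMap.const ℝ (Rd d) (a T)
    + β T • (AffineMap.id ℝ (Rd d) - AffineMap.const ℝ (Rd d) (barycenter T.1))

theorem rtField_apply (a : 𝒯.L0 (Rd d)) (β : 𝒯.L0 ℝ) (T : 𝒯.Element) (x : Rd d) :
    𝒯.rtField a β T x = a T + β T • (x - barycenter T.1) := rfl

/-- Sides whose open cell lies in `ΓD` have their midpoint, hence all of their closed cell, in the
frontier, so every other kind of side has zero jump. A boundary side belongs to one element only,
where zero jump means zero normal component. -/
theorem rtField_mem_RTN (hΩ : IsBoundedLipschitzDomain Ω) (hd : d ≠ 0) {ΓD : Set (Rd d)}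
    (hΓD : ΓD ⊆ frontier Ω) {a : 𝒯.L0 (Rd d)} {β : 𝒯.L0 ℝ}
    (hjump : ∀ p : 𝒯.Facet, ¬ openCell p.side ⊆ ΓD → 𝒯.fluxJump a β p = 0) :
    𝒯.rtField a β ∈ 𝒯.RTN (frontier Ω \ ΓD) := by
  classical
  refine ⟨⟨⟨_, 𝒯.hasWeakDiv_toFun0 hΩ hd (𝒯.rtField_apply a β) fun p hp => hjump p fun h => hp ?_⟩,
    fun T => ⟨a T, β T, 𝒯.rtField_apply a β T⟩⟩, ?_⟩
  · have hS := 𝒯.side_mem_sides hd p.1 p.2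
    exact 𝒯.cell_subset_frontier hΩ hd hS (hΓD (h (𝒯.barycenter_mem_openCell hS.1)))
  · rintro S hS hfr T hT n hn x ⟨hx, _, hxD⟩
    obtain ⟨v, rfl⟩ := 𝒯.exists_eq_side hS hT
    have h0 := hjump ⟨T, v⟩ fun h => hxD (h hx)
    rw [fluxJump, Finset.sum_eq_single (⟨T, v⟩ : 𝒯.Facet)] at h0
    · have h1 : 𝒯.fluxCoeff a β ⟨T, v⟩ = 0 :=
        (mul_eq_zero.1 h0).resolve_left (𝒯.vol_pos T).ne'
      have h2 := (𝒯.inner_outerNormal (𝒯.rtField_apply a β) hd ⟨T, v⟩ hn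
        (intrinsicInterior_subset hx)).1
      rwa [h1, zero_mul] at h2
    · rintro ⟨T', v'⟩ hq hne
      have hq : 𝒯.side T' v' = 𝒯.side T v := (Finset.mem_filter.1 hq).2
      have := 𝒯.eq_of_side_eq hΩ hd hq.symm hfr
      subst this
      exact absurd (by rw [𝒯.side_injective hq]) hne
    · simp

/-- A field that is orthogonal to the gradients of the functions in `CRD` with vanishing means is
the elementwise mean of a Raviart-Thomas field. -/
theorem exists_coeff_fluxJump_eq_zero (hd : d ≠ 0) {ΓD : Set (Rd d)} {a : 𝒯.L0 (Rd d)}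
    (ha : ∀ v ∈ 𝒯.CRD ΓD, (∀ T : 𝒯.Element, v T (barycenter T.1) = 0) →
      ∑ T, 𝒯.vol T * inner ℝ (a T) (𝒯.gradH v T) = 0) :
    ∃ β : 𝒯.L0 ℝ, ∀ p : 𝒯.Facet, ¬ openCell p.side ⊆ ΓD → 𝒯.fluxJump a β p = 0 := by
  classical
  have hd' : (d : ℝ) ≠ 0 := by exact_mod_cast hd
  set W := 𝒯.CRDSubmodule ΓD
  set K : 𝒯.L1 ℝ →ₗ[ℝ] ℝ :=
    ∑ T, 𝒯.vol T • ((innerₗ (Rd d) (a T)).comp ((LinearMap.proj T).comp 𝒯.gradHₗ)) with hK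
  have hKv : ∀ v, K v = ∑ T, 𝒯.vol T * inner ℝ (a T) (𝒯.gradH v T) := by
    intro v
    simp only [hK, LinearMap.sum_apply]
    rfl
  -- Lagrange multipliers: a linear form that vanishes on the common kernel of finitely many forms
  -- is a combination of them. Here these are the element means on `CRD`.
  have hspan := mem_span_of_iInf_ker_le_ker (L := fun T => (𝒯.evalBarycenter T).domRestrict W)
    (K := K.domRestrict W) (by
      intro v hv
      simp only [Submodule.mem_iInf, LinearMap.mem_ker] at hv ⊢
      change K v.1 = 0
      rw [hKv]
      exact ha v.1 v.2 fun T => hv T)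
  obtain ⟨c, hc⟩ := (Submodule.mem_span_range_iff_exists_fun ℝ).1 hspan
  have hc' : ∀ v ∈ 𝒯.CRD ΓD,
      ∑ T, 𝒯.vol T * inner ℝ (a T) (𝒯.gradH v T)
        = ∑ T : 𝒯.Element, c T * v T (barycenter T.1) := by
    intro v hv
    have := LinearMap.congr_fun hc ⟨v, hv⟩
    rw [← hKv]
    simp only [LinearMap.sum_apply] at this
    exact this.symm
  -- This `β` solves `c_T + d β_T |T| = 0`, so the left side of the integration by parts formula
  -- vanishes for every function in `CRD`. Testing with the basis function of a side leaves `d`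
  -- times its flux jump.
  refine ⟨fun T => -(c T / (d * 𝒯.vol T)), fun p hp => ?_⟩
  have hv := 𝒯.crBasis_mem_CRD hd hp
  have h1 := 𝒯.sum_inner_gradH hd a (fun T => -(c T / (d * 𝒯.vol T))) (𝒯.crBasis p.side)
  rw [Finset.sum_add_distrib, hc' _ hv, ← Finset.sum_add_distrib, Finset.sum_eq_zero,
    eq_comm, mul_eq_zero] at h1
  · have h2 := h1.resolve_left hd'
    simp only [𝒯.crBasis_barycenter hd] at h2
    rw [fluxJump, Finset.sum_filter]
    refine Eq.trans (Finset.sum_congr rfl fun q _ => ?_) h2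
    split_ifs <;> simp
  · intro T _
    have := (𝒯.vol_pos T).ne'
    rw [𝒯.proj0_eq hd]
    field_simp
    ring

/-- A finite lower bound `m` of the primal problem is reached by one field: the separating
functional gives `a`, the multipliers give `β`, and `∑ |T| φ*(a_T) ≤ l(∇u₀) - m`, where `l(∇u₀)`
equals minus the divergence term by discrete integration by parts. -/
theorem exists_le_dual (hΩ : IsBoundedLipschitzDomain Ω) (hd : d ≠ 0) {ΓD : Set (Rd d)}
    (hΓD : ΓD ⊆ frontier Ω) {φ : Rd d → EReal} {f : Rd d → ℝ} (hf : ConvexOn ℝ Set.univ f)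
    (hfc : Continuous f) (hφ : ∀ s, φ s = (f s : EReal)) {u₀ : 𝒯.L1 ℝ} (hu₀ : u₀ ∈ 𝒯.CRD ΓD)
    {m : ℝ} (hm : ∀ u ∈ 𝒯.CRD ΓD, 𝒯.proj0 u = 𝒯.proj0 u₀ → m ≤ ∑ T, 𝒯.vol T * f (𝒯.gradH u T)) :
    ∃ z ∈ 𝒯.RTN (frontier Ω \ ΓD), (m : EReal) ≤ dual 𝒯 φ (𝒯.proj0 u₀) z := by
  set J : 𝒯.L0 (Rd d) → ℝ := fun p => ∑ T, 𝒯.vol T * f (p T) with hJ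
  have hJconv : ConvexOn ℝ Set.univ J := by
    refine ⟨convex_univ, fun p _ q _ s t hs ht hst => ?_⟩
    simp only [hJ, smul_eq_mul, Finset.mul_sum]
    rw [← Finset.sum_add_distrib]
    refine Finset.sum_le_sum fun T _ => ?_
    have := hf.2 (Set.mem_univ (p T)) (Set.mem_univ (q T)) hs ht hst
    simp only [smul_eq_mul] at this
    calc 𝒯.vol T * f (s • p T + t • q T) ≤ 𝒯.vol T * (s * f (p T) + t * f (q T)) :=
          mul_le_mul_of_nonneg_left this (𝒯.vol_pos T).le
      _ = _ := by ring
  have hJc : Continuous J := by fun_prop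
  set V : Submodule ℝ (𝒯.L0 (Rd d)) :=
    (𝒯.CRDSubmodule ΓD ⊓ ⨅ T, LinearMap.ker (𝒯.evalBarycenter T)).map 𝒯.gradHₗ with hV
  have hV' : ∀ v ∈ 𝒯.CRD ΓD, (∀ T : 𝒯.Element, v T (barycenter T.1) = 0) → 𝒯.gradH v ∈ V := by
    intro v hv hv0
    refine ⟨v, ⟨hv, ?_⟩, rfl⟩
    simp only [SetLike.mem_coe, Submodule.mem_iInf, LinearMap.mem_ker]
    exact hv0
  obtain ⟨l, hl1, hl2⟩ := exists_dual_of_le_on_affineSubspace hJconv hJc V (𝒯.gradH u₀) (m := m) (by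
    rintro _ ⟨v, ⟨hv, hv0⟩, rfl⟩
    simp only [SetLike.mem_coe, Submodule.mem_iInf, LinearMap.mem_ker] at hv0
    have hadd : 𝒯.gradH u₀ + 𝒯.gradHₗ v = 𝒯.gradH (u₀ + v) := (𝒯.gradHₗ.map_add u₀ v).symm
    rw [hadd]
    refine hm _ ((𝒯.CRDSubmodule ΓD).add_mem hu₀ hv) (funext fun T => ?_)
    have h0 : v T (barycenter T.1) = 0 := hv0 T
    rw [𝒯.proj0_eq hd, 𝒯.proj0_eq hd]
    change u₀ T _ + v T _ = _
    rw [h0, add_zero])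
  obtain ⟨a, ha⟩ := 𝒯.exists_eq_sum_inner l
  obtain ⟨β, hβ⟩ := 𝒯.exists_coeff_fluxJump_eq_zero hd (ΓD := ΓD) (a := a) (fun v hv hv0 => by
    rw [← ha]; exact hl1 _ (hV' v hv hv0))
  have hz := 𝒯.rtField_mem_RTN hΩ hd hΓD hβ
  refine ⟨_, hz, ?_⟩
  have hdiv := (𝒯.weakDiv_spec hz.1.1).setIntegral_cell hΩ hd (𝒯.rtField_apply a β)
  -- The components of `p` vary independently, so the joint bound splits into real bounds `c T` for
  -- the conjugates `φ*(a_T)`.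
  obtain ⟨c, hc1, hc2⟩ := exists_sum_sup_le 𝒯.vol_pos (g := fun T s => inner ℝ (a T) s - f s)
    (M := l (𝒯.gradH u₀) - m) (fun p => by
      have := hl2 p
      rw [ha p] at this
      simp only [mul_sub]
      rw [Finset.sum_sub_distrib]
      exact this)
  have hconj : ∀ T, conj φ (a T) ≤ (c T : EReal) := by
    intro T
    refine iSup_le fun s => ?_
    rw [hφ, ← EReal.coe_sub, EReal.coe_le_coe_iff]
    exact hc1 T s
  have hpair := 𝒯.sum_inner_gradH hd a β u₀
  rw [𝒯.sum_flux_mul_eq_zero hd hβ hu₀, mul_zero, Finset.sum_add_distrib, ← ha] at hpair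
  rw [dual]
  simp only [hdiv, 𝒯.proj0_of_coeff hd (𝒯.rtField_apply a β)]
  have hle : ∑ T : 𝒯.Element, ((𝒯.vol T : EReal) * conj φ (a T)
        + ((𝒯.proj0 u₀ T * (d * β T * 𝒯.vol T) : ℝ) : EReal))
      ≤ ((∑ T, (𝒯.vol T * c T + 𝒯.proj0 u₀ T * (d * β T * 𝒯.vol T)) : ℝ) : EReal) := by
    rw [EReal_coe_sum]
    refine Finset.sum_le_sum fun T _ => ?_
    rw [EReal.coe_add, EReal.coe_mul]
    exact add_le_add_left (mul_le_mul_of_nonneg_left (hconj T)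
      (EReal.coe_nonneg.2 (𝒯.vol_pos T).le)) _
  refine le_trans ?_ (EReal.neg_le_neg_iff.2 hle)
  rw [← EReal.coe_neg, EReal.coe_le_coe_iff, Finset.sum_add_distrib]
  linarith

end Triangulation

theorem IsProperConvexLsc.convexOn {d : ℕ} {φ : Rd d → EReal} (hφ : IsProperConvexLsc φ)
    {f : Rd d → ℝ} (hf : ∀ s, φ s = (f s : EReal)) : ConvexOn ℝ Set.univ f := by
  refine ⟨convex_univ, fun x _ y _ s t hs ht hst => ?_⟩
  have h := hφ.convex (x := (x, f x)) (by simp [hf]) (y := (y, f y)) (by simp [hf]) hs ht hst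
  simpa [hf] using h

end DiscreteDuality

theorem mainTheorem3 {d : ℕ} (hd : d = 2 ∨ d = 3) {Ω : Set (DiscreteDuality.Rd d)}
    (hΩ : DiscreteDuality.IsBoundedLipschitzDomain Ω)
    (𝒯 : DiscreteDuality.Triangulation Ω)
    (ΓD : Set (DiscreteDuality.Rd d)) (hΓD : ΓD ⊆ frontier Ω)
    (φ : DiscreteDuality.Rd d → EReal) (hφ : DiscreteDuality.IsProperConvexLsc φ)
    (ubar : 𝒯.L0 ℝ) (hubar : ubar ∈ 𝒯.proj0 '' 𝒯.CRD ΓD) :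
    (⨆ z ∈ 𝒯.RTN (frontier Ω \ ΓD), DiscreteDuality.dual 𝒯 φ ubar z) ≤
        (⨅ u ∈ {u | u ∈ 𝒯.CRD ΓD ∧ 𝒯.proj0 u = ubar}, DiscreteDuality.primal 𝒯 φ u) ∧
      (DiscreteDuality.IsC1 φ →
        (⨅ u ∈ {u | u ∈ 𝒯.CRD ΓD ∧ 𝒯.proj0 u = ubar}, DiscreteDuality.primal 𝒯 φ u) =
          ⨆ z ∈ 𝒯.RTN (frontier Ω \ ΓD), DiscreteDuality.dual 𝒯 φ ubar z) := by
  have hd0 : d ≠ 0 := by omega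
  have hweak : (⨆ z ∈ 𝒯.RTN (frontier Ω \ ΓD), DiscreteDuality.dual 𝒯 φ ubar z) ≤
      (⨅ u ∈ {u | u ∈ 𝒯.CRD ΓD ∧ 𝒯.proj0 u = ubar}, DiscreteDuality.primal 𝒯 φ u) := by
    refine iSup₂_le fun z hz => le_iInf₂ ?_
    rintro u ⟨hu, rfl⟩
    exact 𝒯.dual_le_primal hΩ hd0 hφ hu hz
  refine ⟨hweak, ?_⟩
  rintro ⟨f, hf, hφf⟩
  refine le_antisymm ?_ hweak
  obtain ⟨u₀, hu₀, rfl⟩ := hubar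
  have hprimal : ∀ u, DiscreteDuality.primal 𝒯 φ u
      = ((∑ T, 𝒯.vol T * f (𝒯.gradH u T) : ℝ) : EReal) := by
    intro u
    rw [DiscreteDuality.primal, DiscreteDuality.EReal_coe_sum]
    exact Finset.sum_congr rfl fun T _ => by rw [hφf, EReal.coe_mul]
  set I := ⨅ u ∈ {u | u ∈ 𝒯.CRD ΓD ∧ 𝒯.proj0 u = 𝒯.proj0 u₀}, DiscreteDuality.primal 𝒯 φ u with hI
  have hIle : ∀ u ∈ 𝒯.CRD ΓD, 𝒯.proj0 u = 𝒯.proj0 u₀ → I ≤ DiscreteDuality.primal 𝒯 φ u :=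
    fun u hu hu' => iInf₂_le u ⟨hu, hu'⟩
  -- An infimum `⊥` leaves nothing to prove. Otherwise it is a real number, since `u₀` is admissible
  -- with finite energy.
  by_cases hbot : I = ⊥
  · rw [hbot]; exact bot_le
  have htop : I ≠ ⊤ := by
    intro h
    have := hIle u₀ hu₀ rfl
    rw [h, hprimal, top_le_iff] at this
    exact EReal.coe_ne_top _ this
  obtain ⟨m, hm⟩ : ∃ m : ℝ, (m : EReal) = I := ⟨I.toReal, EReal.coe_toReal htop hbot⟩
  obtain ⟨z, hz, hle⟩ := 𝒯.exists_le_dual hΩ hd0 hΓD (hφ.convexOn hφf) hf.continuous hφf hu₀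
    (m := m) (fun u hu hu' => by
      have := hIle u hu hu'
      rwa [← hm, hprimal, EReal.coe_le_coe_iff] at this)
  rw [← hm]
  exact hle.trans (le_iSup₂ (f := fun z _ => DiscreteDuality.dual 𝒯 φ (𝒯.proj0 u₀) z) z hz)
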